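/- Let $\Omega\subset\mathbb R^2$ be a bounded Lipschitz domain whose boundary is split into disjoint relatively open parts $\Gamma_R,\Gamma_D$ with $\partial\Omega=\overline{\Gamma_R}\cup\overline{\Gamma_D}$, and let $\Omega_1,\dots,\Omega_J\subset\Omega$ be pairwise disjoint domains covering $\Omega$ up to a null set. Let $a,c$ be real measurable functions on $\Omega$ that are bounded above and below by positive constants almost everywhere, let $\omega>0$, $\kappa=\omega/c$, let $\beta\in L^\infty(\Gamma_R)$ be real-valued, $f\in L^2(\Omega)$, $g\in L^2(\Gamma_R)$, and write $(u,v)_D=\int_D u\overline v$. Put $$\mathcal C(u,v)=\int_\Omega a\nabla u\cdot\nabla\overline v\,dx-(\kappa^2u,v)_\Omega-i(\omega\beta u,v)_{\Gamma_R},\qquad F(v)=(f,v)_\Omega+(g,v)_{\Gamma_R}.$$ For each $j$ let $(b_i^j,\lambda_i^j)_{i\ge1}$ be the Dirichlet eigenpairs on $\Omega_j$, i.e. $b_i^j\in H^1_0(\Omega_j)$ and $$\int_{\Omega_j}a\nabla b_i^j\cdot\nabla\overline v\,dx=\lambda_i^j(\kappa^2b_i^j,v)_{\Omega_j}\quad\text{for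 all }v\in H_0^1(\Omega_j),$$ listed with multiplicity, with $\lambda_1^j\le\lambda_2^j\le\cdots$ and $(\kappa^2b_i^j,b_l^j)_{\Omega_j}=\delta_{il}$; extend $b_i^j$ by zero to $\Omega$. Assume that $\lambda_i^j\ne1$ for all $i,j$. Let $V_B=\bigoplus_jV^j$, where $V^j$ is the $H^1$-closed span of $\{b_i^j: i\ge1\}$, and, for $I_1,\dots,I_J\in\mathbb N_0$, let $V_{B,S}=\bigoplus_j\operatorname{span}\{b_i^j:1\le i\le I_j\}$. Let $u_B\in V_B$ and $u_{B,S}\in V_{B,S}$ satisfy $$\mathcal C(u_B,v)=F(v)\ \text{ for all }v\in V_B,\qquad \mathcal C(u_{B,S},v)=F(v)\ \text{ for all }v\in V_{B,S}.$$ Put $f_\kappa=f/\kappa^2$ and $P^j_{I_j}h=\sum_{i=1}^{I_j}(\kappa^2h,b_i^j)_{\Omega_j}b_i^j$. Then, for every $j$, the minimum of $|\lambda_i^j-1|$ and the maximum of $\lambda_i^j/|\lambda_i^j-1|^2$ over $i\ge I_j+1$ are attained. If $\lambda_*^j$ and $\lambda_\#^j$ are eigenvalues $\lambda_i^j$, $i\ge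 I_j+1$, at which this minimum and this maximum, respectively, are attained, then $$\|\kappa(u_B-u_{B,S})\|_{L^2(\Omega)}^2\le\sum_{j=1}^J\frac1{|\lambda_*^j-1|^2}\,\|\kappa(f_\kappa-P^j_{I_j}f_\kappa)\|_{L^2(\Omega_j)}^2,$$ $$\|\sqrt a\,\nabla(u_B-u_{B,S})\|_{L^2(\Omega)}^2\le\sum_{j=1}^J\frac{\lambda_\#^j}{|\lambda_\#^j-1|^2}\,\|\kappa(f_\kappa-P^j_{I_j}f_\kappa)\|_{L^2(\Omega_j)}^2 .$$ -/

import Mathlib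

open MeasureTheory
open scoped ComplexConjugate

noncomputable section

namespace ACMS

/-- The Euclidean plane. -/
abbrev Plane : Type := EuclideanSpace ℝ (Fin 2)

/-- Bounded connected open sets whose boundary is, locally and in suitable Cartesian coordinates,
the graph of a Lipschitz function, with the set lying on one side of it. -/
structure IsLipschitzDomain (Ω : Set Plane) : Prop where
  isOpen : IsOpen Ω
  isConnected : IsConnected Ω
  isBounded : Bornology.IsBounded Ω
  boundary : ∀ x ∈ frontier Ω, ∃ (Φ : Plane ≃ᵢ Plane) (K : NNReal) (h : ℝ → ℝ),
    Φ 0 = x ∧ h 0 = 0 ∧ LipschitzWith K h ∧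
      ∀ᶠ p in nhds (0 : Plane), Φ p ∈ Ω ↔ p 1 < h (p 0)

/-- `ΓR` (impedance part) and `ΓD` (Dirichlet part) are disjoint, relatively open subsets of the
boundary of `Ω` whose closures cover the boundary. -/
structure IsBoundarySplitting (Ω ΓR ΓD : Set Plane) : Prop where
  relOpenR : ∃ O : Set Plane, IsOpen O ∧ ΓR = O ∩ frontier Ω
  relOpenD : ∃ O : Set Plane, IsOpen O ∧ ΓD = O ∩ frontier Ω
  disjoint : Disjoint ΓR ΓD
  cover : frontier Ω = closure ΓR ∪ closure ΓD

/-- Decomposition of `Ω` into finitely many non-overlapping subdomains. -/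
structure IsPartition (Ω : Set Plane) {J : ℕ} (Ωs : Fin J → Set Plane) : Prop where
  isOpen : ∀ j, IsOpen (Ωs j)
  isConnected : ∀ j, IsConnected (Ωs j)
  subset : ∀ j, Ωs j ⊆ Ω
  disjoint : Pairwise fun j l => Disjoint (Ωs j) (Ωs l)
  cover : volume (Ω \ ⋃ j, Ωs j) = 0

/-- The function `w` is measurable on `Ω` and lies between two positive constants
almost everywhere on `Ω`. -/
def IsUniformlyPositive (Ω : Set Plane) (w : Plane → ℝ) : Prop :=
  AEMeasurable w (volume.restrict Ω) ∧
    ∃ wmin wmax : ℝ, 0 < wmin ∧ ∀ᵐ x ∂volume.restrict Ω, wmin ≤ w x ∧ w x ≤ wmax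

/-- The arc length measure on the boundary of `Ω`. -/
abbrev bdryMeasure (Ω : Set Plane) : Measure Plane := μH[1].restrict (frontier Ω)

/-- The gradient of a complex-valued function on the plane. -/
def grad (φ : Plane → ℂ) (x : Plane) : EuclideanSpace ℂ (Fin 2) :=
  WithLp.toLp 2 fun k => fderiv ℝ φ x (EuclideanSpace.single k 1)

/-- The ambient space `L²(Ω) × L²(Ω; ℂ²) × L²(∂Ω)`. A function of `H¹(Ω)` is recorded as the triple
of its values, its weak gradient and its boundary trace; see `H1`. -/
abbrev Triple (Ω : Set Plane) : Type :=
  Lp ℂ 2 (volume.restrict Ω) × Lp (EuclideanSpace ℂ (Fin 2)) 2 (volume.restrict Ω) ×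
    Lp ℂ 2 (bdryMeasure Ω)

namespace Triple

variable {Ω : Set Plane}

/-- The values of an `H¹` function. -/
def val (u : Triple Ω) : Plane → ℂ := u.1

/-- The weak gradient of an `H¹` function. -/
def grad (u : Triple Ω) : Plane → EuclideanSpace ℂ (Fin 2) := u.2.1

/-- The boundary trace of an `H¹` function. -/
def trace (u : Triple Ω) : Plane → ℂ := u.2.2

end Triple

/-- The triples `(φ|_Ω, ∇φ|_Ω, φ|_∂Ω)` with `φ` a smooth function with compact support in `U`. -/
def smoothTriples (Ω U : Set Plane) : Set (Triple Ω) :=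
  {u | ∃ φ : Plane → ℂ, ContDiff ℝ (⊤ : ℕ∞) φ ∧ HasCompactSupport φ ∧ tsupport φ ⊆ U ∧
    u.val =ᵐ[volume.restrict Ω] φ ∧ u.grad =ᵐ[volume.restrict Ω] grad φ ∧
    u.trace =ᵐ[bdryMeasure Ω] φ}

/-- `H¹(Ω)` for a Lipschitz domain `Ω`: the closure of the smooth functions on the closed domain.
Weak gradient and trace are the continuous extensions of gradient and restriction. -/
def H1 (Ω : Set Plane) : Submodule ℂ (Triple Ω) :=
  (Submodule.span ℂ (smoothTriples Ω Set.univ)).topologicalClosure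

/-- `H¹₀(U)` for an open subset `U` of `Ω`: the closure of the smooth functions with compact support
in `U`, regarded as a subspace of `H¹(Ω)` through extension by zero. -/
def H10 (Ω U : Set Plane) : Submodule ℂ (Triple Ω) :=
  (Submodule.span ℂ (smoothTriples Ω U)).topologicalClosure

theorem H10_le_H1 (Ω U : Set Plane) : H10 Ω U ≤ H1 Ω :=
  Submodule.topologicalClosure_mono (Submodule.span_mono
    fun _ ⟨φ, h1, h2, _, h4⟩ => ⟨φ, h1, h2, Set.subset_univ _, h4⟩)

/-- The form `∫_D a ∇u · conj ∇v`. -/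
def stiffness {Ω : Set Plane} (a : Plane → ℝ) (D : Set Plane) (u v : Triple Ω) : ℂ :=
  ∫ x in D, (a x : ℂ) * ∑ k, u.grad x k * conj (v.grad x k)

/-- The weighted inner product `(κ² u, v)_D = ∫_D κ² u conj v`. -/
def mass (κ : Plane → ℝ) (D : Set Plane) (u v : Plane → ℂ) : ℂ :=
  ∫ x in D, ((κ x : ℂ) ^ 2) * u x * conj (v x)

/-- The Helmholtz form
`∫_Ω a ∇u · conj ∇v - (κ² u, v)_Ω - i (ω β u, v)_ΓR`. -/
def helmholtzForm {Ω : Set Plane} (ΓR : Set Plane) (a κ : Plane → ℝ) (ω : ℝ) (β : Plane → ℝ)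
    (u v : Triple Ω) : ℂ :=
  stiffness a Ω u v - mass κ Ω u.val v.val
    - Complex.I * ∫ x in ΓR, (ω : ℂ) * (β x : ℂ) * u.trace x * conj (v.trace x) ∂μH[1]

/-- The load functional `F(v) = (f, v)_Ω + (g, v)_ΓR`. -/
def load {Ω : Set Plane} (ΓR : Set Plane) (f g : Plane → ℂ) (v : Triple Ω) : ℂ :=
  (∫ x in Ω, f x * conj (v.val x)) + ∫ x in ΓR, g x * conj (v.trace x) ∂μH[1]

/-- `w` satisfies the Dirichlet eigenvalue equation on `U` with eigenvalue `μ`. -/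
def IsEigen {Ω : Set Plane} (U : Set Plane) (a κ : Plane → ℝ) (μ : ℝ) (w : Triple Ω) : Prop :=
  w ∈ H10 Ω U ∧ ∀ v ∈ H10 Ω U, stiffness a U w v = (μ : ℂ) * mass κ U w.val v.val

/-- `(b i, lam i)`, `i = 0, 1, 2, …`, is an enumeration of the Dirichlet eigenpairs on `U`: the
eigenvalues are non-decreasing and repeated according to multiplicity, and the eigenfunctions are
orthonormal with respect to `(κ² ·, ·)_U`. -/
structure IsEigensystem {Ω : Set Plane} (U : Set Plane) (a κ : Plane → ℝ)
    (b : ℕ → Triple Ω) (lam : ℕ → ℝ) : Prop where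
  eigen : ∀ i, IsEigen U a κ (lam i) (b i)
  orthonormal : ∀ i l, mass κ U (b i).val (b l).val = if i = l then 1 else 0
  monotone : Monotone lam
  exhaustive : ∀ (μ : ℝ) (w : Triple Ω), IsEigen U a κ μ w →
    w ∈ Submodule.span ℂ (b '' {i | lam i = μ})

/-- The bubble space `V_B`: the sum of the (closed) spans `V^j` of all bubble functions of the
`j`-th subdomain. -/
def bubbleSpace {Ω : Set Plane} {J : ℕ} (b : Fin J → ℕ → Triple Ω) : Submodule ℂ (Triple Ω) :=
  ⨆ j, (Submodule.span ℂ (Set.range (b j))).topologicalClosure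

/-- The finite-dimensional bubble space: the first `I j` bubble functions of each subdomain. -/
def bubbleSpaceFin {Ω : Set Plane} {J : ℕ} (b : Fin J → ℕ → Triple Ω) (I : Fin J → ℕ) :
    Submodule ℂ (Triple Ω) :=
  ⨆ j, Submodule.span ℂ (b j '' {i | i < I j})

/-- `u` is a solution in `V` of the Helmholtz problem tested with `V`. -/
def IsGalerkinSolution {Ω : Set Plane} (ΓR : Set Plane) (a κ : Plane → ℝ) (ω : ℝ) (β : Plane → ℝ)
    (f g : Plane → ℂ) (V : Submodule ℂ (Triple Ω)) (u : Triple Ω) : Prop :=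
  u ∈ V ∧ ∀ v ∈ V, helmholtzForm ΓR a κ ω β u v = load ΓR f g v

/-- The projection `∑_{i < I} (κ² f, b i)_U b i`. -/
def bubbleProj {Ω : Set Plane} (U : Set Plane) (κ : Plane → ℝ) (b : ℕ → Triple Ω) (I : ℕ)
    (f : Plane → ℂ) : Plane → ℂ :=
  fun x => ∑ i ∈ Finset.range I, mass κ U f (b i).val * (b i).val x

/-- The squared norm `‖κ (f_κ - P f_κ)‖²` in `L²(U)`, where `f_κ = f / κ²` and `P` is the projection
onto the first `I` bubble functions. -/
def dataTail {Ω : Set Plane} (U : Set Plane) (κ : Plane → ℝ) (b : ℕ → Triple Ω) (I : ℕ)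
    (f : Plane → ℂ) : ℝ :=
  ∫ x in U, ‖(κ x : ℂ) *
    (f x / (κ x : ℂ) ^ 2 - bubbleProj U κ b I (fun y => f y / (κ y : ℂ) ^ 2) x)‖ ^ 2

/-- `m` is the value of the sequence `lam` at an index that minimises `|lam i - 1|` over all
`i ≥ I`. -/
def IsLamStar (lam : ℕ → ℝ) (I : ℕ) (m : ℝ) : Prop :=
  ∃ i ∈ Set.Ici I, lam i = m ∧ IsMinOn (fun i => |lam i - 1|) (Set.Ici I) i

/-- `m` is the value of the sequence `lam` at an index that maximises `lam i / |lam i - 1|²` over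
all `i ≥ I`. -/
def IsLamSharp (lam : ℕ → ℝ) (I : ℕ) (m : ℝ) : Prop :=
  ∃ i ∈ Set.Ici I, lam i = m ∧ IsMaxOn (fun i => lam i / |lam i - 1| ^ 2) (Set.Ici I) i

end ACMS

end

/-!
Multiplication by `κ` and by `√a` turns the two forms into `L²` inner products. On bubble functions
the boundary terms vanish, so testing with `b_i^j` gives
`(λ_i^j - 1) (κ² u_B, b_i^j) = (κ² f_κ, b_i^j)`: the equations decouple completely. Hence the
coefficients of the error vanish for `i ≤ I_j` and are those of `f_κ` divided by `λ_i^j - 1`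
otherwise, and Bessel's inequality bounds both norms. In the energy norm each coefficient carries
an additional factor `λ_i^j`.

The minimum and the maximum are attained because the eigenvalues tend to infinity. If they were
bounded, the `L²`-normalised eigenfunctions would be bounded in `H¹₀`, and the Rellich theorem
would force them to tend to zero, being orthogonal. Compactness is obtained from ball averages: by
Bessel's inequality the averages of the eigenfunctions are square summable over `i`, while the
bound `‖u(· + z) - u‖ ≤ |z| ‖∇u‖` keeps each function uniformly close to its averages.
-/

noncomputable section

namespace ACMS

open Filter Topology
open scoped InnerProductSpace ENNReal

section MinkowskiBound

variable {α β E : Type*} [MeasurableSpace α] [MeasurableSpace β] [NormedAddCommGroup E]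
  {p : ℝ≥0∞}

theorem lintegral_enorm_le_eLpNorm_mul (hp : 1 ≤ p) {ν : Measure β} {f : β → E}
    (hf : AEStronglyMeasurable f ν) :
    ∫⁻ z, ‖f z‖ₑ ∂ν ≤ eLpNorm f p ν * ν Set.univ ^ (1 - 1 / p.toReal) := by
  simpa [eLpNorm_one_eq_lintegral_enorm] using eLpNorm_le_eLpNorm_mul_rpow_measure_univ hp hf

theorem eLpNorm_integral_le_of_forall_eLpNorm_le [NormedSpace ℝ E] (hp : 1 ≤ p) (hp' : p ≠ ⊤)
    {μ : Measure α} [SFinite μ] {ν : Measure β} [IsFiniteMeasure ν] {F : α → β → E}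
    (hF : StronglyMeasurable (Function.uncurry F)) {C : ℝ≥0∞}
    (hC : ∀ᵐ z ∂ν, eLpNorm (fun x => F x z) p μ ≤ C) :
    eLpNorm (fun x => ∫ z, F x z ∂ν) p μ ≤ ν Set.univ * C := by
  lift p to NNReal using hp'
  have hp0 : p ≠ 0 := by rintro rfl; simp at hp
  have hq : (0 : ℝ) < p := by positivity
  have jensen (x : α) : ‖∫ z, F x z ∂ν‖ₑ ^ (p : ℝ) ≤
      ν Set.univ ^ ((p : ℝ) - 1) * ∫⁻ z, ‖F x z‖ₑ ^ (p : ℝ) ∂ν := by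
    have hle := (enorm_integral_le_lintegral_enorm (F x)).trans
      (lintegral_enorm_le_eLpNorm_mul hp (ν := ν)
        (hF.comp_measurable measurable_prodMk_left).aestronglyMeasurable)
    calc ‖∫ z, F x z ∂ν‖ₑ ^ (p : ℝ)
        ≤ (eLpNorm (F x) p ν * ν Set.univ ^ (1 - 1 / (p : ℝ))) ^ (p : ℝ) := by gcongr; exact hle
      _ = ν Set.univ ^ ((p : ℝ) - 1) * ∫⁻ z, ‖F x z‖ₑ ^ (p : ℝ) ∂ν := by
          rw [ENNReal.mul_rpow_of_nonneg _ _ hq.le, eLpNorm_nnreal_pow_eq_lintegral hp0,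
            ← ENNReal.rpow_mul, mul_comm, sub_mul, one_mul, one_div_mul_cancel hq.ne']
  have hm : Measurable fun q : α × β => ‖F q.1 q.2‖ₑ ^ (p : ℝ) := hF.enorm.pow_const _
  rw [← ENNReal.rpow_le_rpow_iff hq, eLpNorm_nnreal_pow_eq_lintegral hp0]
  calc ∫⁻ x, ‖∫ z, F x z ∂ν‖ₑ ^ (p : ℝ) ∂μ
      ≤ ∫⁻ x, ν Set.univ ^ ((p : ℝ) - 1) * ∫⁻ z, ‖F x z‖ₑ ^ (p : ℝ) ∂ν ∂μ :=
        lintegral_mono jensen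
    _ = ν Set.univ ^ ((p : ℝ) - 1) * ∫⁻ z, eLpNorm (fun x => F x z) p μ ^ (p : ℝ) ∂ν := by
        rw [lintegral_const_mul _ hm.lintegral_prod_right',
          lintegral_lintegral_swap hm.aemeasurable]
        simp only [eLpNorm_nnreal_pow_eq_lintegral hp0]
    _ ≤ ν Set.univ ^ ((p : ℝ) - 1) * (C ^ (p : ℝ) * ν Set.univ) := by
        rw [← lintegral_const]
        exact mul_le_mul_right (lintegral_mono_ae
          (hC.mono fun z hz => ENNReal.rpow_le_rpow hz hq.le)) _
    _ = (ν Set.univ * C) ^ (p : ℝ) := by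
        have hpow : ν Set.univ ^ (p : ℝ) = ν Set.univ ^ ((p : ℝ) - 1) * ν Set.univ := by
          simpa using ENNReal.rpow_add_of_nonneg (x := ν Set.univ) ((p : ℝ) - 1) 1
            (sub_nonneg.2 (by exact_mod_cast hp)) zero_le_one
        rw [ENNReal.mul_rpow_of_nonneg _ _ hq.le, hpow]
        ring

end MinkowskiBound

section Translation

variable {E F : Type*} [NormedAddCommGroup E] [NormedSpace ℝ E]
  [NormedAddCommGroup F] [NormedSpace ℝ F] [CompleteSpace F]

theorem sub_eq_integral_fderiv {φ : E → F} (hφ : ContDiff ℝ 1 φ) (x z : E) :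
    φ (x + z) - φ x = ∫ t in Set.Ioc (0 : ℝ) 1, fderiv ℝ φ (x + t • z) z := by
  have hderiv (t : ℝ) :
      HasDerivAt (fun t : ℝ => φ (x + t • z)) (fderiv ℝ φ (x + t • z) z) t := by
    have hline : HasDerivAt (fun t : ℝ => x + t • z) z t := by
      simpa using ((hasDerivAt_id t).smul_const z).const_add x
    exact (hφ.differentiable one_ne_zero _).hasFDerivAt.comp_hasDerivAt t hline
  have hcont : Continuous fun t : ℝ => fderiv ℝ φ (x + t • z) z := by
    have := hφ.continuous_fderiv one_ne_zero
    fun_prop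
  rw [← intervalIntegral.integral_of_le zero_le_one,
    intervalIntegral.integral_eq_sub_of_hasDerivAt (fun t _ => hderiv t)
      (hcont.intervalIntegrable 0 1), one_smul, zero_smul, add_zero]

variable [FiniteDimensional ℝ E] [MeasurableSpace E] [BorelSpace E]
  {μ : Measure E} [μ.IsAddHaarMeasure] {p : ℝ≥0∞}

theorem eLpNorm_translate_sub_le (hp : 1 ≤ p) (hp' : p ≠ ⊤) {φ : E → F}
    (hφ : ContDiff ℝ 1 φ) (z : E) :
    eLpNorm (fun x => φ (x + z) - φ x) p μ ≤ ‖z‖ₑ * eLpNorm (fderiv ℝ φ) p μ := by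
  have hcont := hφ.continuous_fderiv one_ne_zero
  have hslice (t : ℝ) : eLpNorm (fun x => fderiv ℝ φ (x + t • z) z) p μ ≤
      ‖z‖ₑ * eLpNorm (fderiv ℝ φ) p μ := by
    calc eLpNorm (fun x => fderiv ℝ φ (x + t • z) z) p μ
        ≤ ‖z‖ₑ * eLpNorm (fun x => fderiv ℝ φ (x + t • z)) p μ := by
          exact eLpNorm_le_mul_eLpNorm_of_ae_le_mul' (c := ‖z‖₊) (ae_of_all _ fun x => by
            simpa [mul_comm, enorm] using (fderiv ℝ φ (x + t • z)).le_opENorm z) p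
      _ = ‖z‖ₑ * eLpNorm (fderiv ℝ φ) p μ := by
          rw [← eLpNorm_comp_measurePreserving hcont.aestronglyMeasurable
            (measurePreserving_add_right μ (t • z))]
          rfl
  have hmeas : Continuous fun q : E × ℝ => fderiv ℝ φ (q.1 + q.2 • z) z := by fun_prop
  simp only [sub_eq_integral_fderiv hφ]
  simpa using eLpNorm_integral_le_of_forall_eLpNorm_le hp hp' hmeas.stronglyMeasurable
    (ν := volume.restrict (Set.Ioc (0 : ℝ) 1)) (Eventually.of_forall hslice)

theorem measure_ball_mul_eLpNorm_le (hp : 1 ≤ p) (hp' : p ≠ ⊤) {w : E → F}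
    (hw : StronglyMeasurable w) (hwp : MemLp w p μ) {L : ℝ≥0∞}
    (hL : ∀ z, eLpNorm (fun x => w (x + z) - w x) p μ ≤ ‖z‖ₑ * L) (S : Set E) (r : ℝ) :
    μ (Metric.ball 0 r) * eLpNorm w p (μ.restrict S) ≤
      eLpNorm (fun x => ∫ z in Metric.ball 0 r, w (x + z) ∂μ) p (μ.restrict S) +
        μ (Metric.ball 0 r) * (ENNReal.ofReal r * L) := by
  set B : Set E := Metric.ball 0 r
  have hB : μ B ≠ ⊤ := measure_ball_lt_top.ne
  have : IsFiniteMeasure (μ.restrict B) := ⟨by simpa using measure_ball_lt_top⟩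
  set A : E → F := fun x => ∫ z in B, w (x + z) ∂μ
  have hA : StronglyMeasurable A := StronglyMeasurable.integral_prod_right
    (f := fun x z => w (x + z)) (hw.comp_measurable measurable_add)
  have hD : StronglyMeasurable fun x => ∫ z in B, (w (x + z) - w x) ∂μ :=
    StronglyMeasurable.integral_prod_right (f := fun x z => w (x + z) - w x)
      ((hw.comp_measurable measurable_add).sub (hw.comp_measurable measurable_fst))
  have hsplit : (fun x => μ.real B • w x) = A - fun x => ∫ z in B, (w (x + z) - w x) ∂μ := by
    ext x
    have hint : Integrable (fun z => w (x + z)) (μ.restrict B) :=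
      ((hwp.comp_measurePreserving (measurePreserving_add_left μ x)).restrict B).integrable hp
    simp [A, integral_sub hint (integrable_const _)]
  have hdiff : eLpNorm (fun x => ∫ z in B, (w (x + z) - w x) ∂μ) p μ ≤
      μ B * (ENNReal.ofReal r * L) := by
    have hball : ∀ᵐ z ∂μ.restrict B,
        eLpNorm (fun x => w (x + z) - w x) p μ ≤ ENNReal.ofReal r * L := by
      filter_upwards [ae_restrict_mem measurableSet_ball] with z hz
      refine (hL z).trans ?_
      gcongr
      rw [← ofReal_norm]
      exact ENNReal.ofReal_le_ofReal (mem_ball_zero_iff.1 hz).le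
    simpa using eLpNorm_integral_le_of_forall_eLpNorm_le hp hp'
      ((hw.comp_measurable measurable_add).sub (hw.comp_measurable measurable_fst)) hball
  calc μ B * eLpNorm w p (μ.restrict S) = eLpNorm (fun x => μ.real B • w x) p (μ.restrict S) := by
        rw [show (fun x => μ.real B • w x) = μ.real B • w from rfl, eLpNorm_const_smul,
          Real.enorm_of_nonneg measureReal_nonneg, ofReal_measureReal hB]
    _ ≤ eLpNorm A p (μ.restrict S) +
        eLpNorm (fun x => ∫ z in B, (w (x + z) - w x) ∂μ) p (μ.restrict S) := by
        rw [hsplit]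
        exact eLpNorm_sub_le hA.aestronglyMeasurable hD.aestronglyMeasurable hp
    _ ≤ _ := by
        gcongr
        exact (eLpNorm_restrict_le _ _ _ _).trans hdiff

end Translation

section Bessel

variable {ι 𝕜 H H' : Type*} [RCLike 𝕜] [NormedAddCommGroup H] [InnerProductSpace 𝕜 H]
  [NormedAddCommGroup H'] [InnerProductSpace 𝕜 H'] {C : ℝ}

variable (𝕜) in
/-- `u` is a Bessel family with constant `C`, in the sense of frame theory. The sums are finite, so
that no summability has to be assumed. -/
def IsBesselFamily (C : ℝ) (u : ι → H) : Prop :=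
  ∀ (y : H) (s : Finset ι), ∑ i ∈ s, ‖⟪u i, y⟫_𝕜‖ ^ 2 ≤ C * ‖y‖ ^ 2

theorem isBesselFamily_map [CompleteSpace H] [CompleteSpace H'] {e : ι → H}
    (he : Orthonormal 𝕜 e) (W : H →L[𝕜] H') : IsBesselFamily 𝕜 (‖W‖ ^ 2) fun i => W (e i) := by
  intro y s
  calc ∑ i ∈ s, ‖⟪W (e i), y⟫_𝕜‖ ^ 2 = ∑ i ∈ s, ‖⟪e i, W.adjoint y⟫_𝕜‖ ^ 2 := by
        simp only [ContinuousLinearMap.adjoint_inner_right]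
    _ ≤ ‖W.adjoint y‖ ^ 2 := he.sum_inner_products_le _
    _ ≤ (‖W‖ * ‖y‖) ^ 2 := by
        gcongr
        simpa using W.adjoint.le_opNorm y
    _ = ‖W‖ ^ 2 * ‖y‖ ^ 2 := mul_pow ..

variable {E : Type*} [NormedAddCommGroup E] [NormedSpace ℝ E] [FiniteDimensional ℝ E]
  [MeasurableSpace E] [BorelSpace E] {μ : Measure E} [μ.IsAddHaarMeasure] {S : Set E}

theorem integral_ball_indicator_eq_inner (hS : MeasurableSet S) (u : Lp 𝕜 2 (μ.restrict S))
    (x : E) (r : ℝ) :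
    ∫ z in Metric.ball 0 r, S.indicator u (x + z) ∂μ =
      ⟪indicatorConstLp 2 (μ := μ.restrict S) (measurableSet_ball (x := x) (ε := r))
        ((Measure.restrict_apply_le _ _).trans_lt measure_ball_lt_top).ne (1 : 𝕜), u⟫_𝕜 := by
  have hball (z : E) : x + z ∈ Metric.ball x r ↔ z ∈ Metric.ball (0 : E) r := by
    simp [dist_eq_norm]
  rw [L2.inner_indicatorConstLp_one, ← integral_indicator measurableSet_ball,
    Measure.restrict_restrict measurableSet_ball, ← setIntegral_indicator hS,
    ← integral_indicator measurableSet_ball,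
    ← integral_add_left_eq_self (fun y => (Metric.ball x r).indicator (S.indicator u) y) x]
  refine integral_congr_ae (ae_of_all _ fun z => ?_)
  by_cases hz : z ∈ Metric.ball (0 : E) r
  · simp only [Set.indicator_of_mem hz, Set.indicator_of_mem ((hball z).2 hz)]
  · simp only [Set.indicator_of_notMem hz, Set.indicator_of_notMem (mt (hball z).1 hz)]

theorem sum_norm_integral_ball_sq_le (hS : MeasurableSet S) {u : ι → Lp 𝕜 2 (μ.restrict S)}
    (hC : 0 ≤ C) (hu : IsBesselFamily 𝕜 C u) (x : E) (r : ℝ) (s : Finset ι) :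
    ∑ i ∈ s, ‖∫ z in Metric.ball 0 r, S.indicator (u i) (x + z) ∂μ‖ ^ 2 ≤
      C * μ.real (Metric.ball 0 r) := by
  simp only [integral_ball_indicator_eq_inner hS, norm_inner_symm _ (u _)]
  refine (hu _ s).trans (mul_le_mul_of_nonneg_left ?_ hC)
  rw [norm_indicatorConstLp two_ne_zero ENNReal.ofNat_ne_top, norm_one, one_mul,
    ENNReal.toReal_ofNat, ← Real.sqrt_eq_rpow, Real.sq_sqrt measureReal_nonneg,
    ← Measure.addHaar_real_ball_center μ x]
  exact ENNReal.toReal_mono measure_ball_lt_top.ne (Measure.restrict_apply_le _ _)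

theorem tendsto_eLpNorm_integral_ball (hS : MeasurableSet S) (hμS : μ S ≠ ⊤)
    {u : ι → Lp 𝕜 2 (μ.restrict S)} (hC : 0 ≤ C) (hu : IsBesselFamily 𝕜 C u) (r : ℝ) :
    Tendsto (fun i => eLpNorm (fun x => ∫ z in Metric.ball 0 r, S.indicator (u i) (x + z) ∂μ) 2
      (μ.restrict S)) cofinite (𝓝 0) := by
  set A : ι → E → 𝕜 := fun i x => ∫ z in Metric.ball 0 r, S.indicator (u i) (x + z) ∂μ
  have hA (i : ι) : Measurable (A i) := (StronglyMeasurable.integral_prod_right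
    (f := fun x z => S.indicator (u i) (x + z))
    (((Lp.stronglyMeasurable (u i)).indicator hS).comp_measurable measurable_add)).measurable
  have hpoint (s : Finset ι) (x : E) :
      ∑ i ∈ s, ‖A i x‖ₑ ^ 2 ≤ ENNReal.ofReal (C * μ.real (Metric.ball 0 r)) := by
    simp only [← ofReal_norm, ← ENNReal.ofReal_pow (norm_nonneg _)]
    rw [← ENNReal.ofReal_sum_of_nonneg fun _ _ => by positivity]
    exact ENNReal.ofReal_le_ofReal (sum_norm_integral_ball_sq_le hS hC hu x r s)
  have hsum (s : Finset ι) : ∑ i ∈ s, ∫⁻ x in S, ‖A i x‖ₑ ^ 2 ∂μ ≤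
      ENNReal.ofReal (C * μ.real (Metric.ball 0 r)) * μ S := by
    rw [← lintegral_finsetSum _ fun i _ => (hA i).enorm.pow_const 2, ← setLIntegral_const]
    exact lintegral_mono (hpoint s)
  have hsq : Tendsto (fun i => ∫⁻ x in S, ‖A i x‖ₑ ^ 2 ∂μ) cofinite (𝓝 0) :=
    ENNReal.tendsto_cofinite_zero_of_tsum_ne_top <| ne_top_of_le_ne_top (by finiteness)
      (ENNReal.summable.tsum_le_of_sum_le hsum)
  have hroot := (ENNReal.continuous_rpow_const (y := 1 / 2)).continuousAt.tendsto.comp hsq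
  simp only [Function.comp_def] at hroot
  simpa [eLpNorm_eq_lintegral_rpow_enorm_toReal two_ne_zero ENNReal.ofNat_ne_top] using hroot

/-- The ball averages of a Bessel family tend to zero, and a uniform translation estimate makes the
functions close to their averages. -/
theorem tendsto_enorm_cofinite_of_isBesselFamily (hS : MeasurableSet S) (hμS : μ S ≠ ⊤)
    {u : ι → Lp 𝕜 2 (μ.restrict S)} (hC : 0 ≤ C) (hu : IsBesselFamily 𝕜 C u) {L : ℝ≥0∞}
    (hLtop : L ≠ ⊤) (hL : ∀ i z, eLpNorm (fun x => S.indicator (u i) (x + z) - S.indicator (u i) x)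
      2 μ ≤ ‖z‖ₑ * L) :
    Tendsto (fun i => ‖u i‖ₑ) cofinite (𝓝 0) := by
  rw [ENNReal.tendsto_nhds_zero]
  intro ε hε
  have hsmall : ∀ᶠ r : ℝ in 𝓝[>] 0, ENNReal.ofReal r * L ≤ ε / 2 := by
    have hlim : Tendsto (fun r : ℝ => ENNReal.ofReal r * L) (𝓝 0) (𝓝 0) := by
      simpa using ENNReal.Tendsto.mul_const
        (ENNReal.continuous_ofReal.tendsto 0) (Or.inr hLtop)
    exact (hlim.mono_left nhdsWithin_le_nhds).eventually_le_const (ENNReal.half_pos hε.ne')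
  obtain ⟨r, hr, hr0⟩ := (hsmall.and self_mem_nhdsWithin).exists
  have hpos : μ (Metric.ball 0 r) ≠ 0 := (Metric.measure_ball_pos μ 0 hr0).ne'
  have hfin : μ (Metric.ball 0 r) ≠ ⊤ := measure_ball_lt_top.ne
  filter_upwards [(tendsto_eLpNorm_integral_ball hS hμS hC hu r).eventually_le_const
    (show 0 < μ (Metric.ball 0 r) * (ε / 2) by simp [pos_iff_ne_zero, hpos, hε.ne'])] with i hi
  have hnorm : eLpNorm (S.indicator (u i)) 2 (μ.restrict S) = ‖u i‖ₑ := by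
    rw [eLpNorm_congr_ae (indicator_ae_eq_restrict hS), Lp.enorm_def]
  rw [← ENNReal.mul_le_mul_iff_right hpos hfin, ← hnorm]
  calc _ ≤ _ := measure_ball_mul_eLpNorm_le one_le_two ENNReal.ofNat_ne_top
        ((Lp.stronglyMeasurable (u i)).indicator hS)
        ((memLp_indicator_iff_restrict hS).2 (Lp.memLp (u i))) (hL i) S r
    _ ≤ μ (Metric.ball 0 r) * (ε / 2) + μ (Metric.ball 0 r) * (ε / 2) := by gcongr
    _ = μ (Metric.ball 0 r) * ε := by rw [← mul_add, ENNReal.add_halves]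

end Bessel

section Orthogonality

variable {ι 𝕜 H L : Type*} [RCLike 𝕜] [NormedAddCommGroup H] [InnerProductSpace 𝕜 H]
  [NormedAddCommGroup L] [InnerProductSpace 𝕜 L]
  {X Y : Type*} [AddCommGroup X] [Module 𝕜 X] [TopologicalSpace X] [IsTopologicalAddGroup X]
  [ContinuousConstSMul 𝕜 X] [AddCommGroup Y] [Module 𝕜 Y] [TopologicalSpace Y]
  [IsTopologicalAddGroup Y] [ContinuousConstSMul 𝕜 Y]

theorem norm_sum_sq_of_pairwise_orthogonal {x : ι → H}
    (hx : Pairwise fun i l => ⟪x i, x l⟫_𝕜 = 0) (s : Finset ι) :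
    ‖∑ i ∈ s, x i‖ ^ 2 = ∑ i ∈ s, ‖x i‖ ^ 2 := by
  classical
  induction s using Finset.induction_on with
  | empty => simp
  | insert i s his ih =>
    have hi : ⟪x i, ∑ l ∈ s, x l⟫_𝕜 = 0 := by
      rw [inner_sum]
      exact Finset.sum_eq_zero fun l hl => hx fun h => his (h ▸ hl)
    rw [Finset.sum_insert his, Finset.sum_insert his, ← ih, sq, sq, sq]
    exact norm_add_sq_eq_norm_sq_add_norm_sq_of_inner_eq_zero _ _ hi

variable (𝕜) in
/-- The closed linear span of a family. -/
abbrev closedSpan (b : ι → X) : Submodule 𝕜 X :=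
  (Submodule.span 𝕜 (Set.range b)).topologicalClosure

theorem mem_closedSpan (b : ι → X) (i : ι) : b i ∈ closedSpan 𝕜 b :=
  Submodule.le_topologicalClosure _ (Submodule.subset_span ⟨i, rfl⟩)

theorem map_mem_closedSpan (T : X →L[𝕜] Y) {b : ι → X} {x : X} (hx : x ∈ closedSpan 𝕜 b) :
    T x ∈ closedSpan 𝕜 fun i => T (b i) := by
  refine map_mem_closure T.continuous hx fun v hv => ?_
  simpa [Submodule.map_span, ← Set.range_comp, Function.comp_def] using
    Submodule.mem_map_of_mem (f := T.toLinearMap) hv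

theorem norm_sq_le_of_mem_closedSpan {g : ι → H} (hg : Pairwise fun i l => ⟪g i, g l⟫_𝕜 = 0)
    {x : H} (hx : x ∈ closedSpan 𝕜 g) {m : ι → 𝕜} (hm : ∀ i, ⟪g i, x⟫_𝕜 = m i * ‖g i‖ ^ 2)
    {C : ℝ} (hC : ∀ s : Finset ι, ∑ i ∈ s, ‖m i‖ ^ 2 * ‖g i‖ ^ 2 ≤ C) : ‖x‖ ^ 2 ≤ C := by
  have hC0 : 0 ≤ C := by simpa using hC ∅
  have hspan : ∀ v ∈ Submodule.span 𝕜 (Set.range g), ‖⟪v, x⟫_𝕜‖ ≤ ‖v‖ * √C := by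
    intro v hv
    obtain ⟨c, rfl⟩ := Finsupp.mem_span_range_iff_exists_finsupp.1 hv
    set y : H := ∑ i ∈ c.support, m i • g i
    have hy : ‖y‖ ≤ √C := by
      refine Real.le_sqrt_of_sq_le ?_
      rw [norm_sum_sq_of_pairwise_orthogonal (𝕜 := 𝕜) fun i l hil => by
        simp only [inner_smul_left, inner_smul_right, hg hil, mul_zero]]
      simpa only [norm_smul, mul_pow] using hC c.support
    have hgy : ∀ i ∈ c.support, ⟪g i, y⟫_𝕜 = ⟪g i, x⟫_𝕜 := by
      intro i hi
      rw [inner_sum, Finset.sum_eq_single_of_mem i hi fun l _ hl => by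
        rw [inner_smul_right, hg hl.symm, mul_zero], inner_smul_right, inner_self_eq_norm_sq_to_K,
        hm]
    have hvy : ⟪c.sum fun i a => a • g i, x⟫_𝕜 = ⟪c.sum fun i a => a • g i, y⟫_𝕜 := by
      simp only [Finsupp.sum, sum_inner, inner_smul_left]
      exact Finset.sum_congr rfl fun i hi => by rw [hgy i hi]
    rw [hvy]
    exact (norm_inner_le_norm _ _).trans (by gcongr)
  have hclosed : IsClosed {v : H | ‖⟪v, x⟫_𝕜‖ ≤ ‖v‖ * √C} :=
    isClosed_le (by fun_prop) (by fun_prop)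
  have hxx : ‖x‖ ^ 2 ≤ ‖x‖ * √C := by
    simpa [inner_self_eq_norm_sq_to_K] using hclosed.closure_subset_iff.2 hspan hx
  nlinarith [Real.sq_sqrt hC0, sq_nonneg (‖x‖ - √C)]

theorem norm_sq_le_of_coeff_le {k : ι → H} (hk : Orthonormal 𝕜 k) {g : ι → L}
    (hg : Pairwise fun i l => ⟪g i, g l⟫_𝕜 = 0) {x : L} (hx : x ∈ closedSpan 𝕜 g) {m : ι → 𝕜}
    (hm : ∀ i, ⟪g i, x⟫_𝕜 = m i * ‖g i‖ ^ 2) {r : H} {C : ℝ} (hC : 0 ≤ C)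
    (hmC : ∀ i, ‖m i‖ ^ 2 * ‖g i‖ ^ 2 ≤ C * ‖⟪k i, r⟫_𝕜‖ ^ 2) : ‖x‖ ^ 2 ≤ C * ‖r‖ ^ 2 :=
  norm_sq_le_of_mem_closedSpan hg hx hm fun s =>
    calc ∑ i ∈ s, ‖m i‖ ^ 2 * ‖g i‖ ^ 2 ≤ ∑ i ∈ s, C * ‖⟪k i, r⟫_𝕜‖ ^ 2 :=
          Finset.sum_le_sum fun i _ => hmC i
      _ ≤ C * ‖r‖ ^ 2 := by
          rw [← Finset.mul_sum]
          exact mul_le_mul_of_nonneg_left (hk.sum_inner_products_le r) hC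

theorem norm_sq_eq_of_sub_one_mul_eq {t : ℝ} (ht : t ≠ 1) {y z : 𝕜} (h : (t - 1) * y = z) :
    ‖y‖ ^ 2 = 1 / |t - 1| ^ 2 * ‖z‖ ^ 2 := by
  have hpos : |t - 1| ≠ 0 := abs_ne_zero.2 (sub_ne_zero.2 ht)
  have hnorm : ‖(t - 1 : 𝕜)‖ = |t - 1| := by
    rw [← RCLike.norm_ofReal (K := 𝕜), RCLike.ofReal_sub, RCLike.ofReal_one]
  rw [← h, norm_mul, hnorm]
  field_simp

variable (𝕜) in
/-- The remainder of `h` after subtracting its Fourier expansion over the indices in `s`. -/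
def fourierTail (k : ι → H) (s : Finset ι) (h : H) : H :=
  h - ∑ i ∈ s, ⟪k i, h⟫_𝕜 • k i

theorem inner_fourierTail [DecidableEq ι] {k : ι → H} (hk : Orthonormal 𝕜 k) (s : Finset ι)
    (h : H) (i : ι) : ⟪k i, fourierTail 𝕜 k s h⟫_𝕜 = if i ∈ s then 0 else ⟪k i, h⟫_𝕜 := by
  split_ifs with hi
  · rw [fourierTail, inner_sub_right, hk.inner_right_sum _ hi, sub_self]
  · simp [fourierTail, inner_sub_right, inner_sum, inner_smul_right, orthonormal_iff_ite.1 hk, hi]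

theorem fourierTail_mem {V : Submodule 𝕜 H} {k : ι → H} (hk : ∀ i, k i ∈ V) (s : Finset ι) {h : H}
    (hh : h ∈ V) : fourierTail 𝕜 k s h ∈ V :=
  sub_mem hh (sum_mem fun i _ => V.smul_mem _ (hk i))

end Orthogonality

section Eigenfamily

variable {ι 𝕜 X H H' : Type*} [RCLike 𝕜] [AddCommGroup X] [Module 𝕜 X] [TopologicalSpace X]
  [IsTopologicalAddGroup X] [ContinuousConstSMul 𝕜 X] [NormedAddCommGroup H]
  [InnerProductSpace 𝕜 H] [NormedAddCommGroup H'] [InnerProductSpace 𝕜 H'] {K : X →L[𝕜] H}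
  {G : X →L[𝕜] H'} {b : ι → X} {lam : ι → ℝ}

/-- Weak eigenpairs `(b i, lam i)` of the form `⟪G ·, G ·⟫` relative to `⟪K ·, K ·⟫`, tested on the
closed span of the eigenvectors and orthonormal for the second form. For the Helmholtz problem `K`
is multiplication by `κ` and `G` is `u ↦ √a ∇u`. -/
structure IsEigenfamily (K : X →L[𝕜] H) (G : X →L[𝕜] H') (b : ι → X) (lam : ι → ℝ) : Prop where
  orthonormal : Orthonormal 𝕜 fun i => K (b i)
  inner_eq : ∀ i, ∀ v ∈ closedSpan 𝕜 b, ⟪G (b i), G v⟫_𝕜 = lam i * ⟪K (b i), K v⟫_𝕜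

namespace IsEigenfamily

theorem inner_grad_eq_zero (hb : IsEigenfamily K G b lam) :
    Pairwise fun i l => ⟪G (b i), G (b l)⟫_𝕜 = 0 := by
  intro i l hil
  rw [hb.inner_eq i _ (mem_closedSpan b l), hb.orthonormal.2 hil, mul_zero]

theorem norm_grad_sq (hb : IsEigenfamily K G b lam) (i : ι) : ‖G (b i)‖ ^ 2 = lam i := by
  have h := hb.inner_eq i _ (mem_closedSpan b i)
  rw [inner_self_eq_norm_sq_to_K, inner_self_eq_norm_sq_to_K, hb.orthonormal.1 i,
    RCLike.ofReal_one, one_pow, mul_one] at h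
  exact_mod_cast h

theorem nonneg (hb : IsEigenfamily K G b lam) (i : ι) : 0 ≤ lam i :=
  hb.norm_grad_sq i ▸ sq_nonneg _

theorem norm_val_sq_le (hb : IsEigenfamily K G b lam) (hlam : ∀ i, lam i ≠ 1) {e : X}
    (he : e ∈ closedSpan 𝕜 b) {r : H}
    (heq : ∀ i, (lam i - 1 : 𝕜) * ⟪K (b i), K e⟫_𝕜 = ⟪K (b i), r⟫_𝕜) {C : ℝ} (hC : 0 ≤ C)
    (hlamC : ∀ i, ⟪K (b i), r⟫_𝕜 ≠ 0 → 1 / |lam i - 1| ^ 2 ≤ C) : ‖K e‖ ^ 2 ≤ C * ‖r‖ ^ 2 := by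
  refine norm_sq_le_of_coeff_le hb.orthonormal hb.orthonormal.2 (map_mem_closedSpan K he)
    (m := fun i => ⟪K (b i), K e⟫_𝕜) (fun i => by simp [hb.orthonormal.1]) hC fun i => ?_
  rw [norm_sq_eq_of_sub_one_mul_eq (hlam i) (heq i), hb.orthonormal.1, one_pow, mul_one]
  by_cases hi : ⟪K (b i), r⟫_𝕜 = 0
  · simp [hi]
  · exact mul_le_mul_of_nonneg_right (hlamC i hi) (sq_nonneg _)

theorem norm_grad_sq_le (hb : IsEigenfamily K G b lam) (hlam : ∀ i, lam i ≠ 1) {e : X}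
    (he : e ∈ closedSpan 𝕜 b) {r : H}
    (heq : ∀ i, (lam i - 1 : 𝕜) * ⟪K (b i), K e⟫_𝕜 = ⟪K (b i), r⟫_𝕜) {C : ℝ} (hC : 0 ≤ C)
    (hlamC : ∀ i, ⟪K (b i), r⟫_𝕜 ≠ 0 → lam i / |lam i - 1| ^ 2 ≤ C) :
    ‖G e‖ ^ 2 ≤ C * ‖r‖ ^ 2 := by
  refine norm_sq_le_of_coeff_le hb.orthonormal hb.inner_grad_eq_zero (map_mem_closedSpan G he)
    (m := fun i => ⟪K (b i), K e⟫_𝕜) (fun i => ?_) hC fun i => ?_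
  · rw [hb.inner_eq i e he, ← hb.norm_grad_sq i, mul_comm]
    push_cast
    rfl
  rw [norm_sq_eq_of_sub_one_mul_eq (hlam i) (heq i), hb.norm_grad_sq,
    mul_right_comm, one_div_mul_eq_div]
  by_cases hi : ⟪K (b i), r⟫_𝕜 = 0
  · simp [hi]
  · exact mul_le_mul_of_nonneg_right (hlamC i hi) (sq_nonneg _)

end IsEigenfamily

end Eigenfamily

section Decoupling

variable {σ : Type*} [Fintype σ]

theorem exists_sum_of_mem_iSup {R M : Type*} [Semiring R] [AddCommMonoid M] [Module R M]
    {V : σ → Submodule R M} {u : M} (hu : u ∈ ⨆ j, V j) :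
    ∃ w : σ → M, (∀ j, w j ∈ V j) ∧ ∑ j, w j = u := by
  obtain ⟨w, hw, rfl⟩ := (Submodule.mem_iSup_iff_exists_finsupp V u).1 hu
  exact ⟨w, hw, by rw [Finsupp.sum_fintype _ _ fun _ => rfl]⟩

variable {ι 𝕜 X H H' : Type*} [RCLike 𝕜] [AddCommGroup X] [Module 𝕜 X] [TopologicalSpace X]
  [IsTopologicalAddGroup X] [ContinuousConstSMul 𝕜 X] [NormedAddCommGroup H]
  [InnerProductSpace 𝕜 H] [NormedAddCommGroup H'] [InnerProductSpace 𝕜 H'] {K : X →L[𝕜] H}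
  {G : X →L[𝕜] H'} {b : σ → ι → X} {lam : σ → ι → ℝ}

/-- A finite family of eigenfamilies whose closed spans are mutually orthogonal for both forms, as
is the case for bubble functions supported in disjoint subdomains. -/
structure Decoupled (K : X →L[𝕜] H) (G : X →L[𝕜] H') (b : σ → ι → X) (lam : σ → ι → ℝ) :
    Prop where
  eigen : ∀ j, IsEigenfamily K G (b j) (lam j)
  orthogonal_val : ∀ j l, j ≠ l → ∀ u ∈ closedSpan 𝕜 (b j), ∀ v ∈ closedSpan 𝕜 (b l),
    ⟪K u, K v⟫_𝕜 = 0
  orthogonal_grad : ∀ j l, j ≠ l → ∀ u ∈ closedSpan 𝕜 (b j), ∀ v ∈ closedSpan 𝕜 (b l),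
    ⟪G u, G v⟫_𝕜 = 0

namespace Decoupled

theorem inner_sum_eq (D : Decoupled K G b lam) {w : σ → X} (hw : ∀ j, w j ∈ closedSpan 𝕜 (b j))
    (j : σ) (i : ι) : ⟪G (b j i), G (∑ l, w l)⟫_𝕜 - ⟪K (b j i), K (∑ l, w l)⟫_𝕜 =
      (lam j i - 1 : 𝕜) * ⟪K (b j i), K (w j)⟫_𝕜 := by
  have hval : ⟪K (b j i), K (∑ l, w l)⟫_𝕜 = ⟪K (b j i), K (w j)⟫_𝕜 := by
    rw [map_sum, inner_sum]
    exact Fintype.sum_eq_single j fun l hl =>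
      D.orthogonal_val j l hl.symm _ (mem_closedSpan _ i) _ (hw l)
  have hgrad : ⟪G (b j i), G (∑ l, w l)⟫_𝕜 = ⟪G (b j i), G (w j)⟫_𝕜 := by
    rw [map_sum, inner_sum]
    exact Fintype.sum_eq_single j fun l hl =>
      D.orthogonal_grad j l hl.symm _ (mem_closedSpan _ i) _ (hw l)
  rw [hval, hgrad, (D.eigen j).inner_eq i _ (hw j)]
  ring

/-- In each subdomain the Galerkin error solves, for all indices, the problem whose datum is the
Fourier remainder of the original one. -/
theorem exists_error_decomposition (D : Decoupled K G b lam) {S : σ → Finset ι} {h : σ → H}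
    {u us : X} (hu : u ∈ ⨆ j, closedSpan 𝕜 (b j))
    (hus : us ∈ ⨆ j, Submodule.span 𝕜 (b j '' (S j : Set ι)))
    (hueq : ∀ j i, ⟪G (b j i), G u⟫_𝕜 - ⟪K (b j i), K u⟫_𝕜 = ⟪K (b j i), h j⟫_𝕜)
    (huseq : ∀ j, ∀ i ∈ S j, ⟪G (b j i), G us⟫_𝕜 - ⟪K (b j i), K us⟫_𝕜 = ⟪K (b j i), h j⟫_𝕜) :
    ∃ e : σ → X, ∑ j, e j = u - us ∧ (∀ j, e j ∈ closedSpan 𝕜 (b j)) ∧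
      ∀ j i, (lam j i - 1 : 𝕜) * ⟪K (b j i), K (e j)⟫_𝕜 =
        ⟪K (b j i), fourierTail 𝕜 (fun i => K (b j i)) (S j) (h j)⟫_𝕜 := by
  classical
  obtain ⟨w, hw, rfl⟩ := exists_sum_of_mem_iSup hu
  obtain ⟨ws, hws, rfl⟩ := exists_sum_of_mem_iSup hus
  have hws' (j : σ) : ws j ∈ closedSpan 𝕜 (b j) := Submodule.le_topologicalClosure _
    (Submodule.span_mono (Set.image_subset_range _ _) (hws j))
  have hzero (j : σ) (i : ι) (hi : i ∉ S j) : ⟪K (b j i), K (ws j)⟫_𝕜 = 0 := by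
    refine Submodule.span_induction (fun x ⟨l, hl, hx⟩ => ?_) (by simp)
      (fun x y _ _ hx hy => by rw [map_add, inner_add_right, hx, hy, add_zero])
      (fun c x _ hx => by rw [map_smul, inner_smul_right, hx, mul_zero]) (hws j)
    exact hx ▸ (D.eigen j).orthonormal.2 fun hil => hi (hil ▸ hl)
  refine ⟨fun j => w j - ws j, Finset.sum_sub_distrib .., fun j => sub_mem (hw j) (hws' j),
    fun j i => ?_⟩
  rw [inner_fourierTail (D.eigen j).orthonormal, map_sub, inner_sub_right, mul_sub,
    ← D.inner_sum_eq hw, hueq]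
  split_ifs with hi
  · rw [← D.inner_sum_eq hws', huseq j i hi, sub_self]
  · rw [hzero j i hi, mul_zero, sub_zero]

variable {e : σ → X} {h : σ → H} {S : σ → Finset ι} {C : σ → ℝ}

theorem norm_val_sum_sq_le (D : Decoupled K G b lam) (hlam : ∀ j i, lam j i ≠ 1)
    (he : ∀ j, e j ∈ closedSpan 𝕜 (b j))
    (heq : ∀ j i, (lam j i - 1 : 𝕜) * ⟪K (b j i), K (e j)⟫_𝕜 =
      ⟪K (b j i), fourierTail 𝕜 (fun i => K (b j i)) (S j) (h j)⟫_𝕜)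
    (hC : ∀ j, 0 ≤ C j) (hlamC : ∀ j, ∀ i ∉ S j, 1 / |lam j i - 1| ^ 2 ≤ C j) :
    ‖K (∑ j, e j)‖ ^ 2 ≤ ∑ j, C j * ‖fourierTail 𝕜 (fun i => K (b j i)) (S j) (h j)‖ ^ 2 := by
  classical
  rw [map_sum, norm_sum_sq_of_pairwise_orthogonal (𝕜 := 𝕜) fun j l hjl =>
    D.orthogonal_val j l hjl _ (he j) _ (he l)]
  refine Finset.sum_le_sum fun j _ =>
    (D.eigen j).norm_val_sq_le (hlam j) (he j) (heq j) (hC j)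
      fun i hi => hlamC j i fun hiS => hi ?_
  rw [inner_fourierTail (D.eigen j).orthonormal, if_pos hiS]

theorem norm_grad_sum_sq_le (D : Decoupled K G b lam) (hlam : ∀ j i, lam j i ≠ 1)
    (he : ∀ j, e j ∈ closedSpan 𝕜 (b j))
    (heq : ∀ j i, (lam j i - 1 : 𝕜) * ⟪K (b j i), K (e j)⟫_𝕜 =
      ⟪K (b j i), fourierTail 𝕜 (fun i => K (b j i)) (S j) (h j)⟫_𝕜)
    (hC : ∀ j, 0 ≤ C j) (hlamC : ∀ j, ∀ i ∉ S j, lam j i / |lam j i - 1| ^ 2 ≤ C j) :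
    ‖G (∑ j, e j)‖ ^ 2 ≤ ∑ j, C j * ‖fourierTail 𝕜 (fun i => K (b j i)) (S j) (h j)‖ ^ 2 := by
  classical
  rw [map_sum, norm_sum_sq_of_pairwise_orthogonal (𝕜 := 𝕜) fun j l hjl =>
    D.orthogonal_grad j l hjl _ (he j) _ (he l)]
  refine Finset.sum_le_sum fun j _ =>
    (D.eigen j).norm_grad_sq_le (hlam j) (he j) (heq j) (hC j)
      fun i hi => hlamC j i fun hiS => hi ?_
  rw [inner_fourierTail (D.eigen j).orthonormal, if_pos hiS]

end Decoupled

end Decoupling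

section ExtremalEigenvalues

variable {lam : ℕ → ℝ}

theorem exists_isLamStar (h : Tendsto lam atTop atTop) (I : ℕ) : ∃ m, IsLamStar lam I m := by
  have hlim : Tendsto (fun i => |lam i - 1|) atTop atTop :=
    tendsto_abs_atTop_atTop.comp (tendsto_atTop_add_const_right _ (-1) h)
  obtain ⟨i, hi, hmin⟩ := ContinuousOn.exists_isMinOn' (f := fun i => |lam i - 1|)
    continuous_of_discreteTopology.continuousOn (isClosed_discrete _) (Set.self_mem_Ici (a := I))
    (by
      rw [cocompact_eq_cofinite, Nat.cofinite_eq_atTop]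
      exact (hlim.eventually_ge_atTop _).filter_mono inf_le_left)
  exact ⟨lam i, i, hi, rfl, hmin⟩

theorem tendsto_div_abs_sub_one_sq :
    Tendsto (fun t : ℝ => t / |t - 1| ^ 2) atTop (𝓝 0) := by
  have hinv : Tendsto (fun t : ℝ => (t - 1)⁻¹) atTop (𝓝 0) :=
    tendsto_inv_atTop_zero.comp (tendsto_atTop_add_const_right _ (-1) tendsto_id)
  have hlim : Tendsto (fun t : ℝ => (t - 1)⁻¹ + (t - 1)⁻¹ ^ 2) atTop (𝓝 0) := by
    simpa using hinv.add (hinv.pow 2)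
  refine hlim.congr' ?_
  filter_upwards [eventually_gt_atTop 1] with t ht
  have : t - 1 ≠ 0 := (sub_pos.2 ht).ne'
  rw [sq_abs]
  field_simp
  ring

theorem exists_isLamSharp (h : Tendsto lam atTop atTop) (h1 : ∀ i, lam i ≠ 1) (I : ℕ) :
    ∃ m, IsLamSharp lam I m := by
  obtain ⟨n, hnI, hn⟩ := ((eventually_ge_atTop I).and (h.eventually_gt_atTop 0)).exists
  have hpos : 0 < lam n / |lam n - 1| ^ 2 :=
    div_pos hn (pow_pos (abs_pos.2 (sub_ne_zero.2 (h1 n))) 2)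
  obtain ⟨i, hi, hmax⟩ := ContinuousOn.exists_isMaxOn' (f := fun i => lam i / |lam i - 1| ^ 2)
    continuous_of_discreteTopology.continuousOn (isClosed_discrete _) (Set.mem_Ici.2 hnI) (by
      rw [cocompact_eq_cofinite, Nat.cofinite_eq_atTop]
      exact ((tendsto_div_abs_sub_one_sq.comp h).eventually_le_const hpos).filter_mono inf_le_left)
  exact ⟨lam i, i, hi, rfl, hmax⟩

theorem IsLamStar.one_div_le {I : ℕ} {m : ℝ} (h : IsLamStar lam I m) (hm : m ≠ 1) {i : ℕ}
    (hi : I ≤ i) : 1 / |lam i - 1| ^ 2 ≤ 1 / |m - 1| ^ 2 := by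
  obtain ⟨n, -, rfl, hmin⟩ := h
  have hpos : 0 < |lam n - 1| := abs_pos.2 (sub_ne_zero.2 hm)
  exact one_div_le_one_div_of_le (by positivity) (pow_le_pow_left₀ hpos.le (hmin hi) 2)

theorem IsLamStar.ne_one {I : ℕ} {m : ℝ} (h : IsLamStar lam I m) (h1 : ∀ i, lam i ≠ 1) :
    m ≠ 1 := by
  obtain ⟨n, -, rfl, -⟩ := h
  exact h1 n

theorem IsLamSharp.div_le {I : ℕ} {m : ℝ} (h : IsLamSharp lam I m) {i : ℕ} (hi : I ≤ i) :
    lam i / |lam i - 1| ^ 2 ≤ m / |m - 1| ^ 2 := by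
  obtain ⟨n, -, rfl, hmax⟩ := h
  exact hmax hi

theorem IsLamSharp.nonneg {I : ℕ} {m : ℝ} (h : IsLamSharp lam I m) (h0 : ∀ i, 0 ≤ lam i) :
    0 ≤ m := by
  obtain ⟨n, -, rfl, -⟩ := h
  exact h0 n

end ExtremalEigenvalues

section LebesgueSpaces

variable {ι α 𝕜 E : Type*} [MeasurableSpace α] {μ : Measure α} [RCLike 𝕜] [NormedAddCommGroup E]

theorem L2_norm_sq_eq_integral (u : Lp E 2 μ) : ‖u‖ ^ 2 = ∫ x, ‖u x‖ ^ 2 ∂μ := by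
  rw [Lp.norm_def, (Lp.memLp u).eLpNorm_eq_integral_rpow_norm two_ne_zero ENNReal.ofNat_ne_top,
    ENNReal.toReal_ofReal (by positivity), ENNReal.toReal_ofNat, ← Real.rpow_two,
    Real.rpow_inv_rpow (by positivity) two_ne_zero]
  simp only [Real.rpow_two]

section Multiplication

variable [NormedSpace 𝕜 E] {p : ℝ≥0∞} [Fact (1 ≤ p)] {w w' : α → 𝕜}

variable (E p) in
/-- Multiplication by an essentially bounded scalar function, as an operator on `Lᵖ`. -/
def multiplier (hw : MemLp w ⊤ μ) : Lp E p μ →L[𝕜] Lp E p μ :=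
  (ContinuousLinearMap.lsmul 𝕜 𝕜 : 𝕜 →L[𝕜] E →L[𝕜] E).holderL μ ⊤ p p hw.toLp

theorem coeFn_multiplier (hw : MemLp w ⊤ μ) (u : Lp E p μ) :
    multiplier E p hw u =ᵐ[μ] fun x => w x • u x := by
  filter_upwards [(ContinuousLinearMap.lsmul 𝕜 𝕜 : 𝕜 →L[𝕜] E →L[𝕜] E).coeFn_holder (r := p)
    hw.toLp u, hw.coeFn_toLp] with x hholder hcoe
  rw [← hcoe]
  exact hholder

theorem multiplier_multiplier_eq_self (hw : MemLp w ⊤ μ) (hw' : MemLp w' ⊤ μ)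
    (h : ∀ᵐ x ∂μ, w' x * w x = 1) (u : Lp E p μ) :
    multiplier E p hw' (multiplier E p hw u) = u := by
  refine Lp.ext ?_
  filter_upwards [coeFn_multiplier hw u, coeFn_multiplier hw' (multiplier E p hw u), h]
    with x hx hx' hone
  rw [hx', hx, smul_smul, hone, one_smul]

end Multiplication

section Support

variable [NormedSpace 𝕜 E] {p : ℝ≥0∞} {S : Set α} {u : Lp E p μ}

variable (μ 𝕜 E p S) in
/-- The functions of `Lᵖ` that vanish almost everywhere outside `S`. -/
def supportedLp : Submodule 𝕜 (Lp E p μ) where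
  carrier := {u | ∀ᵐ x ∂μ, x ∉ S → u x = 0}
  zero_mem' := (Lp.coeFn_zero E p μ).mono fun _ h _ => h
  add_mem' {u v} hu hv := by
    filter_upwards [hu, hv, Lp.coeFn_add u v] with x hux hvx hadd hx
    rw [hadd, Pi.add_apply, hux hx, hvx hx, add_zero]
  smul_mem' c u hu := by
    filter_upwards [hu, Lp.coeFn_smul c u] with x hux hsmul hx
    rw [hsmul, Pi.smul_apply, hux hx, smul_zero]

theorem mem_supportedLp : u ∈ supportedLp 𝕜 E μ p S ↔ ∀ᵐ x ∂μ, x ∉ S → u x = 0 :=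
  Iff.rfl

theorem isClosed_supportedLp [Fact (1 ≤ p)] :
    IsClosed (supportedLp 𝕜 E μ p S : Set (Lp E p μ)) := by
  refine IsSeqClosed.isClosed fun v u hv hlim => ?_
  obtain ⟨n, -, hn⟩ := (tendstoInMeasure_of_tendsto_Lp hlim).exists_seq_tendsto_ae
  filter_upwards [hn, ae_all_iff.2 hv] with x hnx hvx hx
  simp only [hvx _ hx] at hnx
  exact tendsto_nhds_unique hnx tendsto_const_nhds

theorem multiplier_mem_supportedLp [Fact (1 ≤ p)] {w : α → 𝕜} (hw : MemLp w ⊤ μ)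
    (hu : u ∈ supportedLp 𝕜 E μ p S) : multiplier E p hw u ∈ supportedLp 𝕜 E μ p S := by
  filter_upwards [hu, coeFn_multiplier hw u] with x hux hmul hx
  rw [hmul, hux hx, smul_zero]

end Support

variable [InnerProductSpace 𝕜 E] {S T : Set α}

theorem inner_eq_zero_of_mem_supportedLp (hST : Disjoint S T) {u v : Lp E 2 μ}
    (hu : u ∈ supportedLp 𝕜 E μ 2 S) (hv : v ∈ supportedLp 𝕜 E μ 2 T) : ⟪u, v⟫_𝕜 = 0 := by
  rw [L2.inner_def]
  refine integral_eq_zero_of_ae ?_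
  filter_upwards [hu, hv] with x hux hvx
  by_cases hx : x ∈ S
  · rw [hvx (Set.disjoint_left.1 hST hx), inner_zero_right, Pi.zero_apply]
  · rw [hux hx, inner_zero_left, Pi.zero_apply]

theorem coeFn_fourierTail (k : ι → Lp E 2 μ) (s : Finset ι) (h : Lp E 2 μ) :
    (fourierTail 𝕜 k s h : Lp E 2 μ) =ᵐ[μ] fun x => h x - ∑ i ∈ s, ⟪k i, h⟫_𝕜 • k i x := by
  have hsmul : ∀ᵐ x ∂μ, ∀ i ∈ s, (⟪k i, h⟫_𝕜 • k i : Lp E 2 μ) x = ⟪k i, h⟫_𝕜 • k i x :=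
    (ae_ball_iff s.countable_toSet).2 fun i _ => Lp.coeFn_smul _ _
  filter_upwards [Lp.coeFn_sub h (∑ i ∈ s, ⟪k i, h⟫_𝕜 • k i),
    Lp.coeFn_fun_finsetSum s fun i => ⟪k i, h⟫_𝕜 • k i, hsmul] with x hsub hsum hx
  rw [fourierTail, hsub, Pi.sub_apply, hsum, Finset.sum_congr rfl hx]

end LebesgueSpaces

section ZeroExtension

variable {E F : Type*} [NormedAddCommGroup E] [MeasurableSpace E] [BorelSpace E]
  {μ : Measure E} [μ.IsAddRightInvariant] [NormedAddCommGroup F] {p : ℝ≥0∞} {S : Set E}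

theorem eLpNorm_translate_sub_indicator_le (hp : 1 ≤ p) (hS : MeasurableSet S)
    (u v : Lp F p (μ.restrict S)) (z : E) :
    eLpNorm (fun x => S.indicator u (x + z) - S.indicator u x) p μ ≤
      eLpNorm (fun x => S.indicator v (x + z) - S.indicator v x) p μ + 2 * ‖u - v‖ₑ := by
  have hmeas (w : Lp F p (μ.restrict S)) : AEStronglyMeasurable (S.indicator w) μ :=
    ((Lp.stronglyMeasurable w).indicator hS).aestronglyMeasurable
  have htrans := measurePreserving_add_right μ z
  set d : Lp F p (μ.restrict S) := u - v
  have hd : eLpNorm (S.indicator d) p μ = ‖d‖ₑ := by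
    rw [eLpNorm_indicator_eq_eLpNorm_restrict hS, Lp.enorm_def]
  have hdtrans : eLpNorm (fun x => S.indicator d (x + z)) p μ = ‖d‖ₑ :=
    (eLpNorm_comp_measurePreserving (hmeas d) htrans).trans hd
  have hsplit : S.indicator u =ᵐ[μ] S.indicator v + S.indicator d := by
    rw [← Set.indicator_add']
    refine (ae_eq_restrict_iff_indicator_ae_eq hS).1 ?_
    filter_upwards [Lp.coeFn_sub u v] with x hx
    rw [Pi.add_apply, hx, Pi.sub_apply, add_sub_cancel]
  have hsplit_trans := htrans.quasiMeasurePreserving.ae_eq_comp hsplit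
  set D : E → F := fun x => S.indicator v (x + z) - S.indicator v x
  have hD : AEStronglyMeasurable D μ :=
    ((hmeas v).comp_measurePreserving htrans).sub (hmeas v)
  set dz : E → F := fun x => S.indicator d (x + z)
  have hdz : AEStronglyMeasurable dz μ := (hmeas d).comp_measurePreserving htrans
  calc eLpNorm (fun x => S.indicator u (x + z) - S.indicator u x) p μ
      = eLpNorm (D + (dz - S.indicator d)) p μ := by
        refine eLpNorm_congr_ae ?_
        filter_upwards [hsplit, hsplit_trans] with x hx hxz
        simp only [Function.comp_apply, Pi.add_apply] at hx hxz
        simp only [D, dz, Pi.add_apply, Pi.sub_apply, hx, hxz]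
        abel
    _ ≤ eLpNorm D p μ + (eLpNorm dz p μ + eLpNorm (S.indicator d) p μ) :=
        (eLpNorm_add_le hD (hdz.sub (hmeas d)) hp).trans
          (add_le_add_right (eLpNorm_sub_le hdz (hmeas d) hp) _)
    _ = eLpNorm D p μ + 2 * ‖u - v‖ₑ := by rw [hd, hdtrans, two_mul]

end ZeroExtension

section SmoothTriples

variable {Ω U : Set Plane} {φ ψ : Plane → ℂ}

theorem grad_zero : grad 0 = 0 := by
  ext x k
  simp [grad]

theorem grad_add (hφ : Differentiable ℝ φ) (hψ : Differentiable ℝ ψ) :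
    grad (φ + ψ) = grad φ + grad ψ := by
  ext x k
  simp [grad, fderiv_add (hφ x) (hψ x)]

theorem grad_smul (c : ℂ) (hφ : Differentiable ℝ φ) : grad (c • φ) = c • grad φ := by
  ext x k
  simp [grad, fderiv_const_smul (hφ x) c]

theorem grad_eq_zero_of_notMem_tsupport {x : Plane} (hx : x ∉ tsupport φ) : grad φ x = 0 := by
  ext k
  simp [grad, fderiv_of_notMem_tsupport ℝ hx]

theorem norm_fderiv_le_norm_grad (φ : Plane → ℂ) (x : Plane) : ‖fderiv ℝ φ x‖ ≤ ‖grad φ x‖ := by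
  refine ContinuousLinearMap.opNorm_le_bound _ (norm_nonneg _) fun z => ?_
  have hz : fderiv ℝ φ x z = ∑ k, z k • grad φ x k := by
    conv_lhs => rw [← (EuclideanSpace.basisFun (Fin 2) ℝ).sum_repr z]
    simp [grad]
  calc ‖fderiv ℝ φ x z‖ ≤ ∑ k, ‖grad φ x k‖ * ‖z k‖ := by
        rw [hz]
        refine (norm_sum_le _ _).trans_eq (Finset.sum_congr rfl fun k _ => ?_)
        rw [norm_smul, mul_comm]
    _ ≤ ‖grad φ x‖ * ‖z‖ := by
        rw [EuclideanSpace.norm_eq, EuclideanSpace.norm_eq]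
        exact Real.sum_mul_le_sqrt_mul_sqrt _ _ _

theorem zero_mem_smoothTriples : 0 ∈ smoothTriples Ω U :=
  ⟨0, contDiff_const, HasCompactSupport.zero, by simp, Lp.coeFn_zero _ _ _,
    grad_zero ▸ Lp.coeFn_zero _ _ _, Lp.coeFn_zero _ _ _⟩

theorem add_mem_smoothTriples {u v : Triple Ω} (hu : u ∈ smoothTriples Ω U)
    (hv : v ∈ smoothTriples Ω U) : u + v ∈ smoothTriples Ω U := by
  obtain ⟨φ, hφ, hφc, hφU, hval, hgrad, htrace⟩ := hu
  obtain ⟨ψ, hψ, hψc, hψU, hval', hgrad', htrace'⟩ := hv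
  refine ⟨φ + ψ, hφ.add hψ, hφc.add hψc, (tsupport_add _ _).trans (Set.union_subset hφU hψU),
    (Lp.coeFn_add u.1 v.1).trans (hval.add hval'), ?_,
    (Lp.coeFn_add u.2.2 v.2.2).trans (htrace.add htrace')⟩
  rw [grad_add (hφ.differentiable (by simp)) (hψ.differentiable (by simp))]
  exact (Lp.coeFn_add u.2.1 v.2.1).trans (hgrad.add hgrad')

theorem smul_mem_smoothTriples (c : ℂ) {u : Triple Ω} (hu : u ∈ smoothTriples Ω U) :
    c • u ∈ smoothTriples Ω U := by
  obtain ⟨φ, hφ, hφc, hφU, hval, hgrad, htrace⟩ := hu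
  refine ⟨c • φ, hφ.const_smul c, hφc.smul_left (f := fun _ => c),
    (closure_mono (Function.support_const_smul_subset c φ)).trans hφU,
    (Lp.coeFn_smul c u.1).trans (hval.const_smul c), ?_,
    (Lp.coeFn_smul c u.2.2).trans (htrace.const_smul c)⟩
  rw [grad_smul c (hφ.differentiable (by simp))]
  exact (Lp.coeFn_smul c u.2.1).trans (hgrad.const_smul c)

theorem H10_subset_closure_smoothTriples :
    (H10 Ω U : Set (Triple Ω)) ⊆ closure (smoothTriples Ω U) :=
  closure_mono <| Submodule.span_le (p :=
    { carrier := smoothTriples Ω U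
      zero_mem' := zero_mem_smoothTriples
      add_mem' := add_mem_smoothTriples
      smul_mem' := smul_mem_smoothTriples }).2 subset_rfl

theorem eLpNorm_translate_sub_le_of_mem_smoothTriples (hΩ : MeasurableSet Ω) {v : Triple Ω}
    (hv : v ∈ smoothTriples Ω Ω) (z : Plane) :
    eLpNorm (fun x => Ω.indicator v.val (x + z) - Ω.indicator v.val x) 2 volume ≤
      ‖z‖ₑ * ‖v.2.1‖ₑ := by
  obtain ⟨φ, hφ, -, hφΩ, hval, hgrad, -⟩ := hv
  have hval' : Ω.indicator v.val =ᵐ[volume] φ := by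
    have h := (ae_eq_restrict_iff_indicator_ae_eq hΩ).1 hval
    rwa [Set.indicator_eq_self.2 ((subset_tsupport φ).trans hφΩ)] at h
  have hgrad' : eLpNorm (grad φ) 2 volume = ‖v.2.1‖ₑ := by
    rw [Lp.enorm_def, eLpNorm_congr_ae (show v.2.1 =ᵐ[volume.restrict Ω] grad φ from hgrad),
      ← eLpNorm_indicator_eq_eLpNorm_restrict hΩ, Set.indicator_eq_self.2]
    exact Function.support_subset_iff'.2 fun x hx =>
      grad_eq_zero_of_notMem_tsupport fun hmem => hx (hφΩ hmem)
  calc eLpNorm (fun x => Ω.indicator v.val (x + z) - Ω.indicator v.val x) 2 volume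
      = eLpNorm (fun x => φ (x + z) - φ x) 2 volume := by
        refine eLpNorm_congr_ae (EventuallyEq.sub ?_ hval')
        exact (measurePreserving_add_right volume z).quasiMeasurePreserving.ae_eq_comp hval'
    _ ≤ ‖z‖ₑ * eLpNorm (fderiv ℝ φ) 2 volume :=
        eLpNorm_translate_sub_le one_le_two ENNReal.ofNat_ne_top
          (hφ.of_le (by exact_mod_cast le_top)) z
    _ ≤ ‖z‖ₑ * ‖v.2.1‖ₑ := by
        rw [← hgrad']
        gcongr
        exact eLpNorm_mono (norm_fderiv_le_norm_grad φ)

theorem H10_mono {U V : Set Plane} (hUV : U ⊆ V) : H10 Ω U ≤ H10 Ω V :=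
  Submodule.topologicalClosure_mono (Submodule.span_mono
    fun _ ⟨φ, hφ, hφc, hφU, h⟩ => ⟨φ, hφ, hφc, hφU.trans hUV, h⟩)

theorem H10.eLpNorm_translate_sub_le (hΩ : MeasurableSet Ω) {u : Triple Ω} (hu : u ∈ H10 Ω Ω)
    (z : Plane) :
    eLpNorm (fun x => Ω.indicator u.val (x + z) - Ω.indicator u.val x) 2 volume ≤
      ‖z‖ₑ * ‖u.2.1‖ₑ := by
  obtain ⟨v, hv, hlim⟩ := mem_closure_iff_seq_limit.1 (H10_subset_closure_smoothTriples hu)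
  have hbound (n : ℕ) : eLpNorm (fun x => Ω.indicator u.val (x + z) - Ω.indicator u.val x) 2
      volume ≤ ‖z‖ₑ * ‖(v n).2.1‖ₑ + 2 * ‖u.1 - (v n).1‖ₑ :=
    (eLpNorm_translate_sub_indicator_le one_le_two hΩ u.1 (v n).1 z).trans
      (add_le_add_left (eLpNorm_translate_sub_le_of_mem_smoothTriples hΩ (hv n) z) _)
  have hval : Tendsto (fun n => ‖u.1 - (v n).1‖ₑ) atTop (𝓝 0) := by
    simpa using (((continuous_fst.tendsto u).comp hlim).const_sub u.1).enorm
  have hgrad : Tendsto (fun n => ‖(v n).2.1‖ₑ) atTop (𝓝 ‖u.2.1‖ₑ) :=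
    (((continuous_fst.comp continuous_snd).tendsto u).comp hlim).enorm
  have hbound_lim : Tendsto (fun n => ‖z‖ₑ * ‖(v n).2.1‖ₑ + 2 * ‖u.1 - (v n).1‖ₑ) atTop
      (𝓝 (‖z‖ₑ * ‖u.2.1‖ₑ)) := by
    simpa using (ENNReal.Tendsto.const_mul hgrad (Or.inr enorm_ne_top)).add
      (ENNReal.Tendsto.const_mul hval (Or.inr ENNReal.ofNat_ne_top))
  exact ge_of_tendsto' hbound_lim hbound

/-- A form of the Rellich compactness theorem. -/
theorem H10.tendsto_val_of_isBesselFamily {ι : Type*} (hΩ : MeasurableSet Ω) (hvol : volume Ω ≠ ⊤)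
    {u : ι → Triple Ω} (hu : ∀ i, u i ∈ H10 Ω Ω) {C L : ℝ} (hC : 0 ≤ C)
    (hbessel : IsBesselFamily ℂ C fun i => (u i).1) (hL : ∀ i, ‖(u i).2.1‖ ≤ L) :
    Tendsto (fun i => (u i).1) cofinite (𝓝 0) := by
  refine tendsto_zero_iff_enorm_tendsto_zero.2 <|
    tendsto_enorm_cofinite_of_isBesselFamily hΩ hvol hC hbessel (L := ENNReal.ofReal L)
      ENNReal.ofReal_ne_top fun i z => (H10.eLpNorm_translate_sub_le hΩ (hu i) z).trans ?_
  gcongr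
  rw [← ofReal_norm]
  exact ENNReal.ofReal_le_ofReal (hL i)

end SmoothTriples

section Support

variable {Ω U : Set Plane} {u : Triple Ω}

theorem H10_le {V : Submodule ℂ (Triple Ω)} (hV : IsClosed (V : Set (Triple Ω)))
    (h : smoothTriples Ω U ⊆ V) : H10 Ω U ≤ V :=
  Submodule.topologicalClosure_minimal _ (Submodule.span_le.2 h) hV

theorem H10.val_mem_supportedLp (hu : u ∈ H10 Ω U) :
    u.1 ∈ supportedLp ℂ ℂ (volume.restrict Ω) 2 U := by
  refine H10_le (V := (supportedLp ℂ ℂ (volume.restrict Ω) 2 U).comap (LinearMap.fst ℂ _ _))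
    ((isClosed_supportedLp (𝕜 := ℂ)).preimage continuous_fst) ?_ hu
  rintro v ⟨φ, -, -, hφU, hval, -⟩
  filter_upwards [hval] with x hx hxU
  exact hx.trans (image_eq_zero_of_notMem_tsupport fun h => hxU (hφU h))

theorem H10.grad_mem_supportedLp (hu : u ∈ H10 Ω U) :
    u.2.1 ∈ supportedLp ℂ (EuclideanSpace ℂ (Fin 2)) (volume.restrict Ω) 2 U := by
  refine H10_le (V := (supportedLp ℂ (EuclideanSpace ℂ (Fin 2)) (volume.restrict Ω) 2 U).comap
      (LinearMap.fst ℂ _ _ ∘ₗ LinearMap.snd ℂ _ _))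
    ((isClosed_supportedLp (𝕜 := ℂ)).preimage (continuous_fst.comp continuous_snd)) ?_ hu
  rintro v ⟨φ, -, -, hφU, -, hgrad, -⟩
  filter_upwards [hgrad] with x hx hxU
  exact hx.trans (grad_eq_zero_of_notMem_tsupport fun h => hxU (hφU h))

theorem H10.trace_ae_eq_zero (hΩ : IsOpen Ω) (hUΩ : U ⊆ Ω) (hu : u ∈ H10 Ω U) :
    u.trace =ᵐ[bdryMeasure Ω] 0 := by
  have htrace : u.2.2 = 0 := by
    refine H10_le (V := LinearMap.ker (LinearMap.snd ℂ _ _ ∘ₗ LinearMap.snd ℂ _ _))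
      (isClosed_singleton.preimage (continuous_snd.comp continuous_snd)) ?_ hu
    rintro v ⟨φ, -, -, hφU, -, -, htrace⟩
    refine Lp.ext (htrace.trans ?_)
    filter_upwards [ae_restrict_mem isClosed_frontier.measurableSet,
      Lp.coeFn_zero ℂ 2 (bdryMeasure Ω)] with x hx hzero
    rw [hzero]
    exact image_eq_zero_of_notMem_tsupport fun h =>
      (hΩ.frontier_eq ▸ hx).2 (hUΩ (hφU h))
  rw [Triple.trace, htrace]
  exact Lp.coeFn_zero _ _ _

end Support

namespace IsUniformlyPositive

variable {Ω : Set Plane} {w : Plane → ℝ}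

theorem memLp_top (h : IsUniformlyPositive Ω w) :
    MemLp (fun x => (w x : ℂ)) ⊤ (volume.restrict Ω) := by
  obtain ⟨hmeas, wmin, wmax, hpos, hw⟩ := h
  refine memLp_top_of_bound
    (Complex.measurable_ofReal.comp_aemeasurable hmeas).aestronglyMeasurable wmax
    (hw.mono fun x hx => ?_)
  rw [Complex.norm_real, Real.norm_of_nonneg (hpos.le.trans hx.1)]
  exact hx.2

theorem ae_pos (h : IsUniformlyPositive Ω w) : ∀ᵐ x ∂volume.restrict Ω, 0 < w x := by
  obtain ⟨-, wmin, wmax, hpos, hw⟩ := h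
  exact hw.mono fun x hx => hpos.trans_le hx.1

theorem sqrt (h : IsUniformlyPositive Ω w) : IsUniformlyPositive Ω fun x => √(w x) := by
  obtain ⟨hmeas, wmin, wmax, hpos, hw⟩ := h
  exact ⟨hmeas.sqrt, √wmin, √wmax, Real.sqrt_pos.2 hpos, hw.mono fun x hx =>
    ⟨Real.sqrt_le_sqrt hx.1, Real.sqrt_le_sqrt hx.2⟩⟩

theorem const_div (h : IsUniformlyPositive Ω w) {t : ℝ} (ht : 0 < t) :
    IsUniformlyPositive Ω fun x => t / w x := by
  obtain ⟨hmeas, wmin, wmax, hpos, hw⟩ := h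
  exact ⟨hmeas.const_div t, t / max wmin wmax, t / wmin, by positivity, hw.mono fun x hx =>
    ⟨div_le_div_of_nonneg_left ht.le (hpos.trans_le hx.1) (hx.2.trans (le_max_right _ _)),
      div_le_div_of_nonneg_left ht.le hpos hx.1⟩⟩

end IsUniformlyPositive

section Forms

variable {Ω U : Set Plane} {a κ : Plane → ℝ} {u v : Triple Ω}

/-- The map `u ↦ κ u` on `H¹`, under which the weighted mass form becomes the inner product
of `L²`. -/
def weightedVal (hκ : IsUniformlyPositive Ω κ) : Triple Ω →L[ℂ] Lp ℂ 2 (volume.restrict Ω) :=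
  multiplier ℂ 2 hκ.memLp_top ∘L ContinuousLinearMap.fst ℂ _ _

/-- The map `u ↦ √a ∇u` on `H¹`, under which the stiffness form becomes the inner product
of `L²`. -/
def weightedGrad (ha : IsUniformlyPositive Ω a) :
    Triple Ω →L[ℂ] Lp (EuclideanSpace ℂ (Fin 2)) 2 (volume.restrict Ω) :=
  multiplier _ 2 ha.sqrt.memLp_top ∘L ContinuousLinearMap.fst ℂ _ _ ∘L
    ContinuousLinearMap.snd ℂ _ _

theorem coeFn_weightedVal (hκ : IsUniformlyPositive Ω κ) (u : Triple Ω) :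
    weightedVal hκ u =ᵐ[volume.restrict Ω] fun x => (κ x : ℂ) * u.val x :=
  coeFn_multiplier hκ.memLp_top u.1

theorem coeFn_weightedGrad (ha : IsUniformlyPositive Ω a) (u : Triple Ω) :
    weightedGrad ha u =ᵐ[volume.restrict Ω] fun x => (√(a x) : ℂ) • u.grad x :=
  coeFn_multiplier ha.sqrt.memLp_top u.2.1

theorem norm_weightedVal_sq (hκ : IsUniformlyPositive Ω κ) (u : Triple Ω) :
    ‖weightedVal hκ u‖ ^ 2 = ∫ x in Ω, ‖(κ x : ℂ) * u.val x‖ ^ 2 := by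
  rw [L2_norm_sq_eq_integral]
  exact integral_congr_ae ((coeFn_weightedVal hκ u).mono fun x hx => by simp only [hx])

theorem norm_weightedGrad_sq (ha : IsUniformlyPositive Ω a) (u : Triple Ω) :
    ‖weightedGrad ha u‖ ^ 2 = ∫ x in Ω, ‖(√(a x) : ℂ) • u.grad x‖ ^ 2 := by
  rw [L2_norm_sq_eq_integral]
  exact integral_congr_ae ((coeFn_weightedGrad ha u).mono fun x hx => by simp only [hx])

theorem mass_eq_inner (hκ : IsUniformlyPositive Ω κ) (u v : Triple Ω) :
    mass κ Ω u.val v.val = ⟪weightedVal hκ v, weightedVal hκ u⟫_ℂ := by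
  rw [L2.inner_def, mass]
  refine integral_congr_ae ?_
  filter_upwards [coeFn_weightedVal hκ u, coeFn_weightedVal hκ v] with x hu hv
  rw [hu, hv, RCLike.inner_apply, map_mul, Complex.conj_ofReal]
  ring

theorem stiffness_eq_inner (ha : IsUniformlyPositive Ω a) (u v : Triple Ω) :
    stiffness a Ω u v = ⟪weightedGrad ha v, weightedGrad ha u⟫_ℂ := by
  rw [L2.inner_def, stiffness]
  refine integral_congr_ae ?_
  filter_upwards [coeFn_weightedGrad ha u, coeFn_weightedGrad ha v, ha.ae_pos] with x hu hv hpos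
  rw [hu, hv, inner_smul_left, inner_smul_right, Complex.conj_ofReal, ← mul_assoc,
    ← Complex.ofReal_mul, Real.mul_self_sqrt hpos.le, PiLp.inner_apply]
  simp only [RCLike.inner_apply]

theorem setIntegral_eq_of_subset_of_ae_eq_zero {α E : Type*} [MeasurableSpace α] {μ : Measure α}
    [NormedAddCommGroup E] [NormedSpace ℝ E] {S T : Set α} (hST : S ⊆ T) {F : α → E}
    (h : ∀ᵐ x ∂μ.restrict T, x ∉ S → F x = 0) : ∫ x in S, F x ∂μ = ∫ x in T, F x ∂μ := by
  rw [← Measure.restrict_restrict_of_subset hST]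
  exact setIntegral_eq_integral_of_ae_compl_eq_zero h

theorem mass_eq_of_mem_H10 (hUΩ : U ⊆ Ω) (hv : v ∈ H10 Ω U) (w : Plane → ℂ) :
    mass κ U w v.val = mass κ Ω w v.val :=
  setIntegral_eq_of_subset_of_ae_eq_zero hUΩ <|
    (mem_supportedLp.1 (H10.val_mem_supportedLp hv)).mono fun x hx hxU => by
      rw [Triple.val, hx hxU, map_zero, mul_zero]

theorem stiffness_eq_of_mem_H10 (hUΩ : U ⊆ Ω) (hv : v ∈ H10 Ω U) :
    stiffness a U u v = stiffness a Ω u v :=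
  setIntegral_eq_of_subset_of_ae_eq_zero hUΩ <|
    (mem_supportedLp.1 (H10.grad_mem_supportedLp hv)).mono fun x hx hxU => by
      simp [Triple.grad, hx hxU]

theorem weightedVal_mem_supportedLp (hκ : IsUniformlyPositive Ω κ) (hu : u ∈ H10 Ω U) :
    weightedVal hκ u ∈ supportedLp ℂ ℂ (volume.restrict Ω) 2 U :=
  multiplier_mem_supportedLp hκ.memLp_top (H10.val_mem_supportedLp hu)

theorem weightedGrad_mem_supportedLp (ha : IsUniformlyPositive Ω a) (hu : u ∈ H10 Ω U) :
    weightedGrad ha u ∈ supportedLp ℂ (EuclideanSpace ℂ (Fin 2)) (volume.restrict Ω) 2 U :=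
  multiplier_mem_supportedLp ha.sqrt.memLp_top (H10.grad_mem_supportedLp hu)

theorem multiplier_inv_weightedVal (hκ : IsUniformlyPositive Ω κ) (u : Triple Ω) :
    multiplier ℂ 2 (hκ.const_div one_pos).memLp_top (weightedVal hκ u) = u.1 := by
  refine multiplier_multiplier_eq_self _ _ (hκ.ae_pos.mono fun x hx => ?_) u.1
  rw [← Complex.ofReal_mul, one_div_mul_cancel hx.ne', Complex.ofReal_one]

theorem multiplier_inv_weightedGrad (ha : IsUniformlyPositive Ω a) (u : Triple Ω) :
    multiplier _ 2 (ha.sqrt.const_div one_pos).memLp_top (weightedGrad ha u) = u.2.1 := by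
  refine multiplier_multiplier_eq_self _ _ (ha.sqrt.ae_pos.mono fun x hx => ?_) u.2.1
  rw [← Complex.ofReal_mul, one_div_mul_cancel hx.ne', Complex.ofReal_one]

end Forms

section Eigensystem

variable {Ω U : Set Plane} {a κ : Plane → ℝ} {b : ℕ → Triple Ω} {lam : ℕ → ℝ}

theorem IsEigensystem.closedSpan_le (hb : IsEigensystem U a κ b lam) :
    closedSpan ℂ b ≤ H10 Ω U := by
  refine Submodule.topologicalClosure_minimal _ (Submodule.span_le.2 ?_)
    (Submodule.isClosed_topologicalClosure _)
  rintro _ ⟨i, rfl⟩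
  exact (hb.eigen i).1

theorem IsEigen.inner_eq (ha : IsUniformlyPositive Ω a) (hκ : IsUniformlyPositive Ω κ)
    (hUΩ : U ⊆ Ω) {t : ℝ} {w v : Triple Ω} (hw : IsEigen U a κ t w) (hv : v ∈ H10 Ω U) :
    ⟪weightedGrad ha w, weightedGrad ha v⟫_ℂ = t * ⟪weightedVal hκ w, weightedVal hκ v⟫_ℂ := by
  have h := hw.2 v hv
  rw [stiffness_eq_of_mem_H10 hUΩ hv, mass_eq_of_mem_H10 hUΩ hv, stiffness_eq_inner ha,
    mass_eq_inner hκ] at h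
  rw [← inner_conj_symm, h, map_mul, Complex.conj_ofReal, inner_conj_symm]

theorem IsEigensystem.isEigenfamily (ha : IsUniformlyPositive Ω a)
    (hκ : IsUniformlyPositive Ω κ) (hUΩ : U ⊆ Ω) (hb : IsEigensystem U a κ b lam) :
    IsEigenfamily (weightedVal hκ) (weightedGrad ha) b lam where
  orthonormal := by
    refine orthonormal_iff_ite.2 fun i l => ?_
    rw [← mass_eq_inner hκ, ← mass_eq_of_mem_H10 hUΩ (hb.eigen i).1, hb.orthonormal l i]
    simp only [eq_comm]
  inner_eq i _ hv := (hb.eigen i).inner_eq ha hκ hUΩ (hb.closedSpan_le hv)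

theorem decoupled_of_isEigensystem (ha : IsUniformlyPositive Ω a) (hκ : IsUniformlyPositive Ω κ)
    {J : ℕ} {Ωs : Fin J → Set Plane} (hsub : ∀ j, Ωs j ⊆ Ω)
    (hdisj : Pairwise fun j l => Disjoint (Ωs j) (Ωs l)) {b : Fin J → ℕ → Triple Ω}
    {lam : Fin J → ℕ → ℝ} (hb : ∀ j, IsEigensystem (Ωs j) a κ (b j) (lam j)) :
    Decoupled (weightedVal hκ) (weightedGrad ha) b lam where
  eigen j := (hb j).isEigenfamily ha hκ (hsub j)
  orthogonal_val j l hjl _ hu _ hv := inner_eq_zero_of_mem_supportedLp (hdisj hjl)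
    (weightedVal_mem_supportedLp hκ ((hb j).closedSpan_le hu))
    (weightedVal_mem_supportedLp hκ ((hb l).closedSpan_le hv))
  orthogonal_grad j l hjl _ hu _ hv := inner_eq_zero_of_mem_supportedLp (hdisj hjl)
    (weightedGrad_mem_supportedLp ha ((hb j).closedSpan_le hu))
    (weightedGrad_mem_supportedLp ha ((hb l).closedSpan_le hv))

/-- If the eigenvalues stayed bounded, so would the gradients of the eigenfunctions, and the
eigenfunctions would tend to zero by compactness, against their normalisation. -/
theorem IsEigensystem.tendsto_atTop (ha : IsUniformlyPositive Ω a) (hκ : IsUniformlyPositive Ω κ)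
    (hΩ : MeasurableSet Ω) (hvol : volume Ω ≠ ⊤) (hUΩ : U ⊆ Ω) (hb : IsEigensystem U a κ b lam) :
    Tendsto lam atTop atTop := by
  refine tendsto_atTop_atTop_of_monotone hb.monotone fun Λ => ?_
  by_contra! hΛ
  have hfam := hb.isEigenfamily ha hκ hUΩ
  let divκ := multiplier ℂ 2 (hκ.const_div one_pos).memLp_top
  let divsqrt := multiplier (EuclideanSpace ℂ (Fin 2)) 2 (ha.sqrt.const_div one_pos).memLp_top
  have hbessel : IsBesselFamily ℂ (‖divκ‖ ^ 2) fun i => (b i).1 := by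
    simpa only [divκ, multiplier_inv_weightedVal] using isBesselFamily_map hfam.orthonormal divκ
  have hgrad (i : ℕ) : ‖(b i).2.1‖ ≤ ‖divsqrt‖ * √Λ := by
    rw [← multiplier_inv_weightedGrad ha]
    refine divsqrt.le_opNorm_of_le ?_
    exact Real.le_sqrt_of_sq_le ((hfam.norm_grad_sq i).trans_le (hΛ i).le)
  have hval : Tendsto (fun i => (b i).1) atTop (𝓝 0) := by
    rw [← Nat.cofinite_eq_atTop]
    exact H10.tendsto_val_of_isBesselFamily hΩ hvol (fun i => H10_mono hUΩ (hb.eigen i).1)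
      (sq_nonneg _) hbessel hgrad
  have hnorm : Tendsto (fun i => ‖weightedVal hκ (b i)‖) atTop (𝓝 0) :=
    ((multiplier ℂ 2 hκ.memLp_top).continuous.norm.tendsto' 0 0 (by simp)).comp hval
  simp only [hfam.orthonormal.1] at hnorm
  exact one_ne_zero (tendsto_nhds_unique tendsto_const_nhds hnorm)

end Eigensystem

section Data

variable {Ω U : Set Plane} {κ : Plane → ℝ} {f : Plane → ℂ}

theorem memLp_indicator_div (hκ : IsUniformlyPositive Ω κ) (hU : MeasurableSet U)
    (hf : MemLp f 2 (volume.restrict Ω)) :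
    MemLp (U.indicator fun x => f x / (κ x : ℂ)) 2 (volume.restrict Ω) := by
  refine ((hf.smul (r := 2) (hκ.const_div one_pos).memLp_top).ae_eq
    (.of_forall fun x => ?_)).indicator hU
  simp [div_eq_inv_mul]

/-- The function `κ (f / κ²) = f / κ` on `U`, extended by zero. -/
def scaledData (hκ : IsUniformlyPositive Ω κ) (hU : MeasurableSet U)
    (hf : MemLp f 2 (volume.restrict Ω)) : Lp ℂ 2 (volume.restrict Ω) :=
  (memLp_indicator_div hκ hU hf).toLp

variable (hκ : IsUniformlyPositive Ω κ) (hU : MeasurableSet U) (hf : MemLp f 2 (volume.restrict Ω))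

theorem coeFn_scaledData :
    scaledData hκ hU hf =ᵐ[volume.restrict Ω] U.indicator fun x => f x / (κ x : ℂ) :=
  (memLp_indicator_div hκ hU hf).coeFn_toLp

theorem scaledData_mem_supportedLp :
    scaledData hκ hU hf ∈ supportedLp ℂ ℂ (volume.restrict Ω) 2 U :=
  (coeFn_scaledData hκ hU hf).mono fun _ hx hxU => hx.trans (Set.indicator_of_notMem hxU _)

theorem inner_scaledData {v : Triple Ω} (hv : v ∈ H10 Ω U) :
    ⟪weightedVal hκ v, scaledData hκ hU hf⟫_ℂ = ∫ x in Ω, f x * conj (v.val x) := by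
  rw [L2.inner_def]
  refine integral_congr_ae ?_
  filter_upwards [coeFn_weightedVal hκ v, coeFn_scaledData hκ hU hf, hκ.ae_pos,
    H10.val_mem_supportedLp hv] with x hval hdata hpos hsupp
  have hκx : (κ x : ℂ) ≠ 0 := by exact_mod_cast hpos.ne'
  rw [hval, hdata, RCLike.inner_apply, map_mul, Complex.conj_ofReal]
  by_cases hx : x ∈ U
  · rw [Set.indicator_of_mem hx]
    field_simp
  · rw [Triple.val, hsupp hx, map_zero, mul_zero, mul_zero, mul_zero]

theorem mass_div_sq_eq (hUΩ : U ⊆ Ω) {v : Triple Ω} (hv : v ∈ H10 Ω U) :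
    mass κ U (fun y => f y / (κ y : ℂ) ^ 2) v.val =
      ⟪weightedVal hκ v, scaledData hκ hU hf⟫_ℂ := by
  rw [mass_eq_of_mem_H10 hUΩ hv, inner_scaledData hκ hU hf hv]
  refine integral_congr_ae (hκ.ae_pos.mono fun x hx => ?_)
  have hκx : (κ x : ℂ) ≠ 0 := by exact_mod_cast hx.ne'
  simp only [mul_div_cancel₀ _ (pow_ne_zero 2 hκx)]

theorem dataTail_eq (hUΩ : U ⊆ Ω) {b : ℕ → Triple Ω} (hb : ∀ i, b i ∈ H10 Ω U) (N : ℕ) :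
    dataTail U κ b N f = ‖fourierTail ℂ (fun i => weightedVal hκ (b i)) (Finset.range N)
      (scaledData hκ hU hf)‖ ^ 2 := by
  have hsupp := fourierTail_mem (fun i => weightedVal_mem_supportedLp hκ (hb i)) (Finset.range N)
    (scaledData_mem_supportedLp hκ hU hf)
  rw [L2_norm_sq_eq_integral, dataTail, ← setIntegral_eq_of_subset_of_ae_eq_zero hUΩ
    ((mem_supportedLp.1 hsupp).mono fun x hx hxU => by
      rw [hx hxU, norm_zero, zero_pow two_ne_zero])]
  refine integral_congr_ae ?_
  filter_upwards [ae_restrict_mem hU, ae_restrict_of_ae_restrict_of_subset hUΩ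
    (coeFn_fourierTail (𝕜 := ℂ) (fun i => weightedVal hκ (b i)) (Finset.range N)
      (scaledData hκ hU hf)),
    ae_restrict_of_ae_restrict_of_subset hUΩ (coeFn_scaledData hκ hU hf),
    ae_restrict_of_ae_restrict_of_subset hUΩ hκ.ae_pos,
    ae_restrict_of_ae_restrict_of_subset hUΩ
      (ae_all_iff.2 fun i => coeFn_weightedVal hκ (b i))] with x hx htail hdata hpos hval
  have hκx : (κ x : ℂ) ≠ 0 := by exact_mod_cast hpos.ne'
  rw [htail, hdata, Set.indicator_of_mem hx, bubbleProj, mul_sub, Finset.mul_sum]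
  congr 3
  · field_simp
  · refine Finset.sum_congr rfl fun i _ => ?_
    rw [mass_div_sq_eq hκ hU hf hUΩ (hb i), hval, smul_eq_mul, mul_left_comm]

theorem setIntegral_trace_eq_zero {ΓR : Set Plane} (hΓ : ΓR ⊆ frontier Ω) (hΩ : IsOpen Ω)
    (hUΩ : U ⊆ Ω) {v : Triple Ω} (hv : v ∈ H10 Ω U) (F : Plane → ℂ) :
    ∫ x in ΓR, F x * conj (v.trace x) ∂μH[1] = 0 := by
  refine integral_eq_zero_of_ae ?_
  filter_upwards [ae_mono (Measure.restrict_mono_set μH[1] hΓ) (H10.trace_ae_eq_zero hΩ hUΩ hv)]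
    with x hx
  simp only [hx, Pi.zero_apply, map_zero, mul_zero]

theorem helmholtz_inner_eq {a : Plane → ℝ} (ha : IsUniformlyPositive Ω a) {ΓR : Set Plane}
    (hΓ : ΓR ⊆ frontier Ω) (hΩ : IsOpen Ω) (hUΩ : U ⊆ Ω) {ω : ℝ} {β : Plane → ℝ}
    {g : Plane → ℂ} {u v : Triple Ω} (hv : v ∈ H10 Ω U)
    (h : helmholtzForm ΓR a κ ω β u v = load ΓR f g v) :
    ⟪weightedGrad ha v, weightedGrad ha u⟫_ℂ - ⟪weightedVal hκ v, weightedVal hκ u⟫_ℂ =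
      ⟪weightedVal hκ v, scaledData hκ hU hf⟫_ℂ := by
  rw [helmholtzForm, load, setIntegral_trace_eq_zero hΓ hΩ hUΩ hv,
    setIntegral_trace_eq_zero hΓ hΩ hUΩ hv, stiffness_eq_inner ha, mass_eq_inner hκ,
    mul_zero, sub_zero, add_zero] at h
  rw [h, inner_scaledData hκ hU hf hv]

end Data

section Galerkin

variable {Ω ΓR : Set Plane} {J : ℕ} {Ωs : Fin J → Set Plane} {a κ : Plane → ℝ}
  {b : Fin J → ℕ → Triple Ω} {lam : Fin J → ℕ → ℝ}

theorem mem_bubbleSpace (j : Fin J) (i : ℕ) : b j i ∈ bubbleSpace b :=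
  le_iSup (fun j => closedSpan ℂ (b j)) j (mem_closedSpan (b j) i)

theorem mem_bubbleSpaceFin {I : Fin J → ℕ} {j : Fin J} {i : ℕ} (hi : i < I j) :
    b j i ∈ bubbleSpaceFin b I :=
  le_iSup (fun j => Submodule.span ℂ (b j '' {i | i < I j})) j
    (Submodule.subset_span ⟨i, hi, rfl⟩)

theorem exists_galerkin_error_decomposition (hΩ : IsOpen Ω) (hΓ : ΓR ⊆ frontier Ω)
    (hmeas : ∀ j, MeasurableSet (Ωs j)) (hsub : ∀ j, Ωs j ⊆ Ω)
    (hdisj : Pairwise fun j l => Disjoint (Ωs j) (Ωs l)) (ha : IsUniformlyPositive Ω a)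
    (hκ : IsUniformlyPositive Ω κ) {ω : ℝ} {β : Plane → ℝ} {f g : Plane → ℂ}
    (hf : MemLp f 2 (volume.restrict Ω)) (hb : ∀ j, IsEigensystem (Ωs j) a κ (b j) (lam j))
    {I : Fin J → ℕ} {u us : Triple Ω}
    (hu : IsGalerkinSolution ΓR a κ ω β f g (bubbleSpace b) u)
    (hus : IsGalerkinSolution ΓR a κ ω β f g (bubbleSpaceFin b I) us) :
    ∃ e : Fin J → Triple Ω, ∑ j, e j = u - us ∧ (∀ j, e j ∈ closedSpan ℂ (b j)) ∧
      ∀ j i, (lam j i - 1 : ℂ) * ⟪weightedVal hκ (b j i), weightedVal hκ (e j)⟫_ℂ =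
        ⟪weightedVal hκ (b j i), fourierTail ℂ (fun i => weightedVal hκ (b j i))
          (Finset.range (I j)) (scaledData hκ (hmeas j) hf)⟫_ℂ := by
  have hmem (j : Fin J) (i : ℕ) : b j i ∈ H10 Ω (Ωs j) := ((hb j).eigen i).1
  refine (decoupled_of_isEigensystem ha hκ hsub hdisj hb).exists_error_decomposition hu.1 ?_
    (fun j i => helmholtz_inner_eq hκ (hmeas j) hf ha hΓ hΩ (hsub j) (hmem j i)
      (hu.2 _ (mem_bubbleSpace j i)))
    (fun j i hi => helmholtz_inner_eq hκ (hmeas j) hf ha hΓ hΩ (hsub j) (hmem j i)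
      (hus.2 _ (mem_bubbleSpaceFin (Finset.mem_range.1 hi))))
  simp only [Finset.coe_range]
  exact hus.1

end Galerkin

end ACMS

end

theorem mainTheorem1_general {Ω ΓR : Set ACMS.Plane} (hΩ : IsOpen Ω) (hvol : volume Ω ≠ ⊤)
    (hΓ : ΓR ⊆ frontier Ω) {J : ℕ} {Ωs : Fin J → Set ACMS.Plane}
    (hmeas : ∀ j, MeasurableSet (Ωs j)) (hsub : ∀ j, Ωs j ⊆ Ω)
    (hdisj : Pairwise fun j l => Disjoint (Ωs j) (Ωs l)) {a κ : ACMS.Plane → ℝ}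
    (ha : ACMS.IsUniformlyPositive Ω a) (hκ : ACMS.IsUniformlyPositive Ω κ) {ω : ℝ}
    {β : ACMS.Plane → ℝ} {f g : ACMS.Plane → ℂ} (hf : MemLp f 2 (volume.restrict Ω))
    {b : Fin J → ℕ → ACMS.Triple Ω} {lam : Fin J → ℕ → ℝ}
    (hb : ∀ j, ACMS.IsEigensystem (Ωs j) a κ (b j) (lam j)) (hlam : ∀ j i, lam j i ≠ 1)
    {I : Fin J → ℕ} {uB uBS : ACMS.Triple Ω}
    (huB : ACMS.IsGalerkinSolution ΓR a κ ω β f g (ACMS.bubbleSpace b) uB)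
    (huBS : ACMS.IsGalerkinSolution ΓR a κ ω β f g (ACMS.bubbleSpaceFin b I) uBS) :
    (∀ j, ∃ m, ACMS.IsLamStar (lam j) (I j) m) ∧
    (∀ j, ∃ m, ACMS.IsLamSharp (lam j) (I j) m) ∧
    (∀ lamStar : Fin J → ℝ, (∀ j, ACMS.IsLamStar (lam j) (I j) (lamStar j)) →
      ∫ x in Ω, ‖(κ x : ℂ) * (uB - uBS).val x‖ ^ 2 ≤
        ∑ j, 1 / |lamStar j - 1| ^ 2 * ACMS.dataTail (Ωs j) κ (b j) (I j) f) ∧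
    (∀ lamSharp : Fin J → ℝ, (∀ j, ACMS.IsLamSharp (lam j) (I j) (lamSharp j)) →
      ∫ x in Ω, ‖(√(a x) : ℂ) • (uB - uBS).grad x‖ ^ 2 ≤
        ∑ j, lamSharp j / |lamSharp j - 1| ^ 2 *
          ACMS.dataTail (Ωs j) κ (b j) (I j) f) := by
  have hgrow j := (hb j).tendsto_atTop ha hκ hΩ.measurableSet hvol (hsub j)
  have D := ACMS.decoupled_of_isEigensystem ha hκ hsub hdisj hb
  obtain ⟨e, hsum, he, heq⟩ :=
    ACMS.exists_galerkin_error_decomposition hΩ hΓ hmeas hsub hdisj ha hκ hf hb huB huBS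
  have htail j := ACMS.dataTail_eq hκ (hmeas j) hf (hsub j) (fun i => ((hb j).eigen i).1) (I j)
  simp only [← ACMS.norm_weightedVal_sq hκ, ← ACMS.norm_weightedGrad_sq ha, htail, ← hsum]
  refine ⟨fun j => ACMS.exists_isLamStar (hgrow j) _,
    fun j => ACMS.exists_isLamSharp (hgrow j) (hlam j) _, fun lamStar hstar => ?_,
    fun lamSharp hsharp => ?_⟩
  · exact D.norm_val_sum_sq_le hlam he heq (fun j => by positivity) fun j i hi =>
      (hstar j).one_div_le ((hstar j).ne_one (hlam j)) (by simpa using hi)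
  · have hnonneg j : 0 ≤ lamSharp j := (hsharp j).nonneg (D.eigen j).nonneg
    exact D.norm_grad_sum_sq_le hlam he heq (fun j => div_nonneg (hnonneg j) (sq_nonneg _))
      fun j i hi => (hsharp j).div_le (by simpa using hi)

theorem mainTheorem1
    (Ω ΓR ΓD : Set ACMS.Plane) (hΩ : ACMS.IsLipschitzDomain Ω)
    (hΓ : ACMS.IsBoundarySplitting Ω ΓR ΓD)
    (J : ℕ) (Ωs : Fin J → Set ACMS.Plane) (hΩs : ACMS.IsPartition Ω Ωs)
    (a c : ACMS.Plane → ℝ) (ha : ACMS.IsUniformlyPositive Ω a)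
    (hc : ACMS.IsUniformlyPositive Ω c)
    (ω : ℝ) (hω : 0 < ω) (κ : ACMS.Plane → ℝ) (hκ : ∀ x, κ x = ω / c x)
    (β : ACMS.Plane → ℝ) (hβ : MemLp β ⊤ (μH[1].restrict ΓR))
    (f g : ACMS.Plane → ℂ) (hf : MemLp f 2 (volume.restrict Ω))
    (hg : MemLp g 2 (μH[1].restrict ΓR))
    (b : Fin J → ℕ → ACMS.Triple Ω) (lam : Fin J → ℕ → ℝ)
    (hb : ∀ j, ACMS.IsEigensystem (Ωs j) a κ (b j) (lam j))
    (hlam : ∀ j i, lam j i ≠ 1)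
    (I : Fin J → ℕ) (uB uBS : ACMS.Triple Ω)
    (huB : ACMS.IsGalerkinSolution ΓR a κ ω β f g (ACMS.bubbleSpace b) uB)
    (huBS : ACMS.IsGalerkinSolution ΓR a κ ω β f g (ACMS.bubbleSpaceFin b I) uBS) :
    (∀ j, ∃ m, ACMS.IsLamStar (lam j) (I j) m) ∧
    (∀ j, ∃ m, ACMS.IsLamSharp (lam j) (I j) m) ∧
    (∀ lamStar : Fin J → ℝ, (∀ j, ACMS.IsLamStar (lam j) (I j) (lamStar j)) →
      ∫ x in Ω, ‖(κ x : ℂ) * (uB - uBS).val x‖ ^ 2 ≤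
        ∑ j, 1 / |lamStar j - 1| ^ 2 * ACMS.dataTail (Ωs j) κ (b j) (I j) f) ∧
    (∀ lamSharp : Fin J → ℝ, (∀ j, ACMS.IsLamSharp (lam j) (I j) (lamSharp j)) →
      ∫ x in Ω, ‖(√(a x) : ℂ) • (uB - uBS).grad x‖ ^ 2 ≤
        ∑ j, lamSharp j / |lamSharp j - 1| ^ 2 *
          ACMS.dataTail (Ωs j) κ (b j) (I j) f) := by
  obtain rfl : κ = fun x => ω / c x := funext hκ
  obtain ⟨O, -, rfl⟩ := hΓ.relOpenR
  exact mainTheorem1_general hΩ.isOpen hΩ.isBounded.measure_lt_top.ne Set.inter_subset_right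
    (fun j => (hΩs.isOpen j).measurableSet) hΩs.subset hΩs.disjoint ha (hc.const_div hω) hf hb hlam
    huB huBS
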